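/- **Setting.** Let $n\ge 2$ and let $\Delta=\bigcap_{i=1}^n\{w\in\mathbb R^2 : \langle w,v_i\rangle\ge a_i\}$ be a Delzant convex polyhedral set with primitive inward-pointing normals $v_i=(\alpha_i,\beta_i)\in\mathbb Z^2$, ordered counter-clockwise, with $v_1=(1,0)$, $v_n=(0,1)$, $a_1=a_n=0$, where each $v_i$ defines a non-trivial (one-dimensional) edge of $\Delta$, and the normals of adjacent edges form a basis of $\mathbb Z^2$. Let $K_\Delta$ be the kernel of the homomorphism $(S^1)^n\to(S^1)^2$ induced by $e_i\mapsto v_i$, let $$U_\Delta=\{x\in\mathbb C^n : \tfrac12(\alpha_i|x_1|^2-|x_i|^2+\beta_i|x_n|^2)=a_i \text{ for all } 1<i<n\},$$ and let $M_\Delta=U_\Delta/K_\Delta$ be the corner manifold obtained by symplectic reduction, with the reduced symplectic form $\omega_\Delta$ (the form whose pullback to $U_\Delta$ is the restriction of the standard form of $\mathbb C^n$), the $(S^1)^2$-action $(\lambda_1,\lambda_2)\cdot[x]=[\lambda_1x_1,x_2,\dots,x_{n-1},\lambda_2x_n]$ and the moment map $\Phi_\Delta([x])=\frac12(|x_1|^2,|x_n|^2)$.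 The anti-diagonal circle is $\{(\lambda,\lambda^{-1})\}$; the diagonal circle $\{(\lambda,\lambda)\}$ has the moment map $\frac12(|x_1|^2+|x_n|^2)$. Put $S_i=\{p\in M_\Delta : \langle\Phi_\Delta(p),v_i\rangle=a_i\}=\{[x] : x_i=0\}$ for $1\le i\le n$, and let $D=\bigcup_{1<i<n}S_i$ be the chain of isotropy spheres. The symplectic blowup map is $$\psi\colon M_\Delta\smallsetminus D\to\mathbb C^2,\qquad [x]\mapsto\left(x_1\,\frac{\prod_{1<i<n}x_i^{\alpha_i}}{\left|\prod_{1<i<n}x_i^{\alpha_i}\right|},\; x_n\,\frac{\prod_{1<i<n}x_i^{\beta_i}}{\left|\prod_{1<i<n}x_i^{\beta_i}\right|}\right),$$ a homeomorphism onto an open subset of $\mathbb C^2$. The mirror $\Delta'$ of $\Delta$ is its reflection across the line $w_1=w_2$, given by $a_i'=a_{n+1-i}$ and $v_i'=(\beta_{n+1-i},\alpha_{n+1-i})$; let $S_i'$, $D'$, $\psi'$ be the corresponding objects for $M_{\Delta'}$. **Lemma.** The map $\mathbb C^n\to\mathbb C^n$, $(x_1,\dots,x_n)\mapsto(-\overline{x}_n,\overline{x}_{n-1},\dots,\overline{x}_1)$,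 takes $U_\Delta$ to $U_{\Delta'}$ and induces a diffeomorphism $F\colon M_\Delta\to M_{\Delta'}$ such that - $F^*\omega_{\Delta'}=-\omega_\Delta$; - $F$ intertwines the moment maps of the diagonal circle actions on $M_\Delta$ and $M_{\Delta'}$; - $F$ is equivariant with respect to the anti-diagonal circle actions; - $F(S_i)=S'_{n+1-i}$ for all $1\le i\le n$ (in particular for the isotropy spheres, $1<i<n$); - for every $z=(z_1,z_2)\in\psi(M_\Delta\smallsetminus D)$ one has $F(\psi^{-1}(z))\in M_{\Delta'}\smallsetminus D'$ and $(\psi'\circ F\circ\psi^{-1})(z_1,z_2)=(-\overline{z}_2,\overline{z}_1)$. -/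

import Mathlib

open scoped ComplexConjugate Manifold ContDiff

/-- The determinant of a pair of vectors of `ℤ²`. -/
def latticeDet (u v : ℤ × ℤ) : ℤ := u.1 * v.2 - u.2 * v.1

/-- The pairing `⟨w, v⟩` of `w ∈ ℝ²` with an integral vector `v`. -/
def latticePairing (w : ℝ × ℝ) (v : ℤ × ℤ) : ℝ := w.1 * v.1 + w.2 * v.2

/-- The data `(v_i, a_i)`, `1 ≤ i ≤ n`, of a Delzant convex polyhedral set
`Δ = ⋂ i, {w ∈ ℝ² | ⟨w, v_i⟩ ≥ a_i}` that is the moment image of a corner manifold.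
Here `n = m + 2`, and the indices `1, …, n` are the elements `0, …, m + 1` of `Fin (m + 2)`. -/
structure CornerPolygon (m : ℕ) where
  /-- The inward-pointing normal vectors `v_i = (α_i, β_i)`. -/
  normal : Fin (m + 2) → ℤ × ℤ
  /-- The constants `a_i`. -/
  level : Fin (m + 2) → ℝ
  normal_zero : normal 0 = (1, 0)
  normal_last : normal (Fin.last (m + 1)) = (0, 1)
  level_zero : level 0 = 0
  level_last : level (Fin.last (m + 1)) = 0
  primitive : ∀ i, IsCoprime (normal i).1 (normal i).2
  /-- The normals are listed counter-clockwise, from `(1, 0)` to `(0, 1)`. -/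
  ccw : ∀ i j, i < j → 0 < latticeDet (normal i) (normal j)
  /-- Each `v_i` defines a non-trivial (one-dimensional) edge of `Δ`. -/
  edge_nontrivial : ∀ i,
    {w : ℝ × ℝ | latticePairing w (normal i) = level i ∧
      ∀ j, level j ≤ latticePairing w (normal j)}.Nontrivial
  /-- Normals of adjacent edges form a basis of `ℤ²`. -/
  delzant : ∀ i : Fin (m + 1), IsUnit (latticeDet (normal i.castSucc) (normal i.succ))

namespace CornerPolygon

noncomputable section

variable {m : ℕ}

/-- The polyhedral set `Δ ⊆ ℝ²` itself. -/
def carrier (Δ : CornerPolygon m) : Set (ℝ × ℝ) :=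
  {w | ∀ j, Δ.level j ≤ latticePairing w (Δ.normal j)}

/-! ### The mirror polygon -/

/-- The mirror `Δ'`, with `a'_i = a_{n+1-i}` and `v'_i = (β_{n+1-i}, α_{n+1-i})`. -/
def mirror (Δ : CornerPolygon m) : CornerPolygon m where
  normal i := (Δ.normal i.rev).swap
  level i := Δ.level i.rev
  normal_zero := by simp [Δ.normal_last]
  normal_last := by simp [Δ.normal_zero]
  level_zero := by simp [Δ.level_last]
  level_last := by simp [Δ.level_zero]
  primitive i := (Δ.primitive i.rev).symm
  ccw i j h := by
    have := Δ.ccw j.rev i.rev (by simpa using h)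
    simp only [latticeDet, Prod.fst_swap, Prod.snd_swap] at this ⊢
    linarith
  edge_nontrivial i := by
    obtain ⟨w, ⟨hw, hw'⟩, z, ⟨hz, hz'⟩, hne⟩ := Δ.edge_nontrivial i.rev
    refine ⟨w.swap, ⟨?_, fun j => ?_⟩, z.swap, ⟨?_, fun j => ?_⟩,
      fun h => hne (Prod.swap_injective h)⟩
    · simpa [latticePairing, add_comm] using hw
    · simpa [latticePairing, add_comm] using hw' j.rev
    · simpa [latticePairing, add_comm] using hz
    · simpa [latticePairing, add_comm] using hz' j.rev
  delzant i := by
    have := Δ.delzant i.rev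
    rw [← Fin.rev_succ, ← Fin.rev_castSucc] at this
    simp only [latticeDet, Prod.fst_swap, Prod.snd_swap] at this ⊢
    convert this using 1
    ring

/-- The mirror is the reflection of `Δ` across the line `w₁ = w₂`. -/
theorem mem_mirror_carrier (Δ : CornerPolygon m) (w : ℝ × ℝ) :
    w ∈ Δ.mirror.carrier ↔ w.swap ∈ Δ.carrier := by
  constructor
  · intro h j
    simpa [latticePairing, mirror, add_comm] using h j.rev
  · intro h j
    simpa [latticePairing, mirror, add_comm] using h j.rev

/-! ### Symplectic reduction -/

/-- The homomorphism `(S¹)ⁿ → (S¹)²` induced by `π(e_i) = v_i`. -/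
def torusHom (Δ : CornerPolygon m) : (Fin (m + 2) → Circle) →* Circle × Circle where
  toFun k := (∏ l, k l ^ (Δ.normal l).1, ∏ l, k l ^ (Δ.normal l).2)
  map_one' := by simp
  map_mul' k k' := by simp [mul_zpow, Finset.prod_mul_distrib]

/-- The group `K`, the kernel of `(S¹)ⁿ → (S¹)²`. -/
def K (Δ : CornerPolygon m) : Subgroup (Fin (m + 2) → Circle) := Δ.torusHom.ker

/-- The level set `U_Δ ⊆ ℂⁿ` of the moment map of the `K`-action. -/
def U (Δ : CornerPolygon m) : Set (Fin (m + 2) → ℂ) :=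
  {x | ∀ i, i ≠ 0 → i ≠ Fin.last (m + 1) →
    (1 / 2 : ℝ) * ((Δ.normal i).1 * ‖x 0‖ ^ 2 - ‖x i‖ ^ 2
      + (Δ.normal i).2 * ‖x (Fin.last (m + 1))‖ ^ 2) = Δ.level i}

/-- `K` acts on `U_Δ` by the restriction of the standard action of `(S¹)ⁿ` on `ℂⁿ`. -/
instance (Δ : CornerPolygon m) : MulAction Δ.K Δ.U where
  smul k x := ⟨fun l => (k.1 l : ℂ) * x.1 l, fun i h0 h1 => by
    simpa [Circle.norm_coe] using x.2 i h0 h1⟩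
  one_smul x := Subtype.ext (funext fun l => by
    change ((1 : Circle) : ℂ) * x.1 l = x.1 l
    simp)
  mul_smul k k' x := Subtype.ext (funext fun l => by
    change ((k.1 l * k'.1 l : Circle) : ℂ) * x.1 l = (k.1 l : ℂ) * ((k'.1 l : ℂ) * x.1 l)
    simp [mul_assoc])

theorem smul_apply (Δ : CornerPolygon m) (k : Δ.K) (x : Δ.U) (l : Fin (m + 2)) :
    (k • x).1 l = (k.1 l : ℂ) * x.1 l := rfl

/-- The reduced space `M_Δ = U_Δ / K`. -/
def M (Δ : CornerPolygon m) : Type := MulAction.orbitRel.Quotient Δ.K Δ.U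

/-- `M_Δ` carries the quotient topology. -/
instance (Δ : CornerPolygon m) : TopologicalSpace Δ.M :=
  inferInstanceAs (TopologicalSpace (Quotient (MulAction.orbitRel Δ.K Δ.U)))

/-- The point `[x] ∈ M_Δ` of `x ∈ U_Δ`. -/
def proj (Δ : CornerPolygon m) (x : Δ.U) : Δ.M := Quotient.mk (MulAction.orbitRel Δ.K Δ.U) x

theorem proj_surjective (Δ : CornerPolygon m) : Function.Surjective Δ.proj := Quotient.mk_surjective

theorem continuous_proj (Δ : CornerPolygon m) : Continuous Δ.proj := continuous_quotient_mk'

theorem proj_eq_proj (Δ : CornerPolygon m) {x y : Δ.U} :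
    Δ.proj x = Δ.proj y ↔ ∃ k : Δ.K, k • y = x := by
  exact Quotient.eq (r := MulAction.orbitRel Δ.K Δ.U)

theorem proj_smul (Δ : CornerPolygon m) (k : Δ.K) (x : Δ.U) : Δ.proj (k • x) = Δ.proj x :=
  Δ.proj_eq_proj.2 ⟨k, rfl⟩

/-- Descend a `K`-invariant map to `M_Δ`. -/
def lift (Δ : CornerPolygon m) {X : Type*} (f : Δ.U → X) (hf : ∀ (k : Δ.K) x, f (k • x) = f x) :
    Δ.M → X :=
  Quotient.lift f (by rintro _ x ⟨k, rfl⟩; exact hf k x)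

@[simp] theorem lift_proj (Δ : CornerPolygon m) {X : Type*} (f : Δ.U → X)
    (hf : ∀ (k : Δ.K) x, f (k • x) = f x) (x : Δ.U) : Δ.lift f hf (Δ.proj x) = f x := rfl

/-- The moment map `Φ_Δ [x] = ½ (|x₁|², |x_n|²)` of the `(S¹)²`-action. -/
def momentMap (Δ : CornerPolygon m) : Δ.M → ℝ × ℝ :=
  Δ.lift (fun x => (1 / 2 * ‖x.1 0‖ ^ 2, 1 / 2 * ‖x.1 (Fin.last (m + 1))‖ ^ 2))
    (fun k x => by simp [smul_apply, Circle.norm_coe])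

/-- The moment map of the diagonal circle `{(λ, λ)}`, that is `w₁ + w₂`. -/
def diagMomentMap (Δ : CornerPolygon m) (p : Δ.M) : ℝ := (Δ.momentMap p).1 + (Δ.momentMap p).2

/-- The representative `(λ₁ x₁, x₂, …, x_{n-1}, λ₂ x_n)`. -/
def torusActU (Δ : CornerPolygon m) (c : Circle × Circle) (x : Δ.U) : Δ.U :=
  ⟨fun l => (if l = 0 then (c.1 : ℂ) else if l = Fin.last (m + 1) then (c.2 : ℂ) else 1) * x.1 l,
    fun i h0 h1 => by simpa [h0, h1, Circle.norm_coe] using x.2 i h0 h1⟩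

/-- The action `(λ₁, λ₂) · [x₁, …, x_n] = [λ₁ x₁, x₂, …, x_{n-1}, λ₂ x_n]` of `(S¹)²` on `M_Δ`. -/
def torusAct (Δ : CornerPolygon m) (c : Circle × Circle) : Δ.M → Δ.M :=
  Δ.lift (fun x => Δ.proj (Δ.torusActU c x)) (fun k x => by
    rw [← Δ.proj_smul k (Δ.torusActU c x)]
    congr 1
    apply Subtype.ext
    funext l
    simp only [smul_apply, torusActU]
    ring)

/-- The action of the anti-diagonal circle `{(λ, λ⁻¹)}`. -/
def antidiagAct (Δ : CornerPolygon m) (c : Circle) : Δ.M → Δ.M := Δ.torusAct (c, c⁻¹)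

/-- `S_i = {p | ⟨Φ(p), v_i⟩ = a_i}`; for `1 < i < n` this is an isotropy sphere. -/
def sphere (Δ : CornerPolygon m) (i : Fin (m + 2)) : Set Δ.M :=
  {p | latticePairing (Δ.momentMap p) (Δ.normal i) = Δ.level i}

/-- The chain of isotropy spheres `D = ⋃ S_i`, `1 < i < n`. -/
def chain (Δ : CornerPolygon m) : Set Δ.M :=
  ⋃ (i : Fin (m + 2)) (_ : i ≠ 0) (_ : i ≠ Fin.last (m + 1)), Δ.sphere i

/-! ### Charts

If `v_i, v_j` is an oriented basis of `ℤ²`, then `v_l = c_l v_i + d_l v_j` with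
`c_l = det (v_l, v_j)` and `d_l = det (v_i, v_l)`, and on the open set of all `[x]` with
`x_l ≠ 0` for `l ≠ i, j` there are the coordinates
`z₁ = x_i ∏ (x_l / |x_l|) ^ c_l`, `z₂ = x_j ∏ (x_l / |x_l|) ^ d_l`. They depend smoothly on `x`,
and their inverse is the composition of `U_Δ → M_Δ` with a smooth map to `U_Δ`. So the atlas of
these charts is the smooth structure for which `U_Δ → M_Δ` is a submersion. -/

/-- The coordinates `(z₁, z₂)` of `[x]`. -/
def coord (Δ : CornerPolygon m) (i j : Fin (m + 2)) (x : Fin (m + 2) → ℂ) : ℂ × ℂ :=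
  (x i * ((∏ l ∈ {i, j}ᶜ, x l ^ latticeDet (Δ.normal l) (Δ.normal j)) /
      (‖∏ l ∈ {i, j}ᶜ, x l ^ latticeDet (Δ.normal l) (Δ.normal j)‖ : ℂ)),
    x j * ((∏ l ∈ {i, j}ᶜ, x l ^ latticeDet (Δ.normal i) (Δ.normal l)) /
      (‖∏ l ∈ {i, j}ᶜ, x l ^ latticeDet (Δ.normal i) (Δ.normal l)‖ : ℂ)))

/-- The value of `½ |x_l|²` at the point with coordinates `z`. -/
def height (Δ : CornerPolygon m) (i j l : Fin (m + 2)) (z : ℂ × ℂ) : ℝ :=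
  latticeDet (Δ.normal l) (Δ.normal j) * (Δ.level i + 1 / 2 * ‖z.1‖ ^ 2)
    + latticeDet (Δ.normal i) (Δ.normal l) * (Δ.level j + 1 / 2 * ‖z.2‖ ^ 2) - Δ.level l

/-- The point of `U_Δ` with `x_i = z₁`, `x_j = z₂`, and positive real entries otherwise. -/
def localSection (Δ : CornerPolygon m) (i j : Fin (m + 2)) (z : ℂ × ℂ) : Fin (m + 2) → ℂ :=
  fun l => if l = i then z.1 else if l = j then z.2 else (Real.sqrt (2 * Δ.height i j l z) : ℂ)

/-- The set of all `z ∈ ℂ²` that are coordinates of a point. -/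
def chartTarget (Δ : CornerPolygon m) (i j : Fin (m + 2)) : Set (ℂ × ℂ) :=
  {z | ∀ l, l ≠ i → l ≠ j → 0 < Δ.height i j l z}

theorem norm_sq_of_mem_U (Δ : CornerPolygon m) {x : Fin (m + 2) → ℂ} (hx : x ∈ Δ.U)
    (l : Fin (m + 2)) :
    ‖x l‖ ^ 2 = (Δ.normal l).1 * ‖x 0‖ ^ 2 + (Δ.normal l).2 * ‖x (Fin.last (m + 1))‖ ^ 2
      - 2 * Δ.level l := by
  by_cases h0 : l = 0
  · subst h0; simp [Δ.normal_zero, Δ.level_zero]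
  by_cases h1 : l = Fin.last (m + 1)
  · subst h1; simp [Δ.normal_last, Δ.level_last]
  have := hx l h0 h1
  linarith

theorem ne_of_det {Δ : CornerPolygon m} {i j : Fin (m + 2)}
    (h : latticeDet (Δ.normal i) (Δ.normal j) = 1) : i ≠ j := by
  rintro rfl
  simp [latticeDet, mul_comm] at h

theorem height_eq (Δ : CornerPolygon m) {i j : Fin (m + 2)}
    (h : latticeDet (Δ.normal i) (Δ.normal j) = 1) {x : Fin (m + 2) → ℂ} (hx : x ∈ Δ.U)
    {z : ℂ × ℂ} (h1 : ‖z.1‖ = ‖x i‖) (h2 : ‖z.2‖ = ‖x j‖) (l : Fin (m + 2)) :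
    Δ.height i j l z = 1 / 2 * ‖x l‖ ^ 2 := by
  have h' : ((Δ.normal i).1 : ℝ) * (Δ.normal j).2 - (Δ.normal i).2 * (Δ.normal j).1 = 1 := by
    exact_mod_cast h
  rw [height, h1, h2, Δ.norm_sq_of_mem_U hx i, Δ.norm_sq_of_mem_U hx j, Δ.norm_sq_of_mem_U hx l]
  simp only [latticeDet]
  push_cast
  linear_combination (1 / 2 * (((Δ.normal l).1 : ℝ) * ‖x 0‖ ^ 2
    + (Δ.normal l).2 * ‖x (Fin.last (m + 1))‖ ^ 2)) * h'

theorem localSection_mem (Δ : CornerPolygon m) {i j : Fin (m + 2)}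
    (h : latticeDet (Δ.normal i) (Δ.normal j) = 1) {z : ℂ × ℂ} (hz : z ∈ Δ.chartTarget i j) :
    Δ.localSection i j z ∈ Δ.U := by
  have h' : ((Δ.normal i).1 : ℝ) * (Δ.normal j).2 - (Δ.normal i).2 * (Δ.normal j).1 = 1 := by
    exact_mod_cast h
  have hij := ne_of_det h
  have key : ∀ l, ‖Δ.localSection i j z l‖ ^ 2 = 2 * Δ.height i j l z := by
    intro l
    by_cases hi : l = i
    · subst hi
      simp only [localSection, height, if_true, h]
      simp only [latticeDet]
      push_cast
      ring
    by_cases hj : l = j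
    · subst hj
      simp only [localSection, height, if_true, h, if_neg hi]
      simp only [latticeDet]
      push_cast
      ring
    simp only [localSection, if_neg hi, if_neg hj, Complex.norm_real, Real.norm_eq_abs, sq_abs]
    exact Real.sq_sqrt (by have := hz l hi hj; linarith)
  intro l _ _
  rw [key, key, key]
  simp only [height, Δ.normal_zero, Δ.normal_last, Δ.level_zero, Δ.level_last]
  simp only [latticeDet]
  push_cast
  ring

theorem prod_zpow_eq_one (Δ : CornerPolygon m) (k : Δ.K) (v : ℤ × ℤ) :
    ∏ l, k.1 l ^ latticeDet (Δ.normal l) v = 1 := by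
  have hk : Δ.torusHom k.1 = 1 := k.2
  have h1 : ∏ l, k.1 l ^ (Δ.normal l).1 = 1 := congrArg Prod.fst hk
  have h2 : ∏ l, k.1 l ^ (Δ.normal l).2 = 1 := congrArg Prod.snd hk
  simp only [latticeDet, zpow_sub, zpow_mul, Finset.prod_mul_distrib, Finset.prod_inv_distrib,
    Finset.prod_zpow, h1, h2]
  simp

theorem coe_prod (s : Finset (Fin (m + 2))) (f : Fin (m + 2) → Circle) (c : Fin (m + 2) → ℤ) :
    ((∏ l ∈ s, f l ^ c l : Circle) : ℂ) = ∏ l ∈ s, (f l : ℂ) ^ c l := by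
  exact (map_prod Circle.coeHom _ s).trans (Finset.prod_congr rfl fun l _ => rfl)

theorem phase_smul {i j a : Fin (m + 2)} {c : Fin (m + 2) → ℤ} {k : Fin (m + 2) → Circle} (hk : ∏ l, k l ^ c l = 1)
    (hai : ∏ l ∈ {i, j}, k l ^ c l = k a) (x : Fin (m + 2) → ℂ) :
    ((k a : ℂ) * x a) * ((∏ l ∈ {i, j}ᶜ, ((k l : ℂ) * x l) ^ c l) /
      (‖∏ l ∈ {i, j}ᶜ, ((k l : ℂ) * x l) ^ c l‖ : ℂ))
    = x a * ((∏ l ∈ {i, j}ᶜ, x l ^ c l) / (‖∏ l ∈ {i, j}ᶜ, x l ^ c l‖ : ℂ)) := by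
  rw [← Finset.prod_mul_prod_compl {i, j}, hai] at hk
  have hk' : (k a : ℂ) * ∏ l ∈ {i, j}ᶜ, (k l : ℂ) ^ c l = 1 := by
    rw [← coe_prod, ← Circle.coe_mul, hk, Circle.coe_one]
  have hn : ‖∏ l ∈ {i, j}ᶜ, (k l : ℂ) ^ c l‖ = 1 := by
    rw [← coe_prod, Circle.norm_coe]
  simp only [mul_zpow, Finset.prod_mul_distrib, norm_mul, hn, one_mul]
  linear_combination (x a * ((∏ l ∈ {i, j}ᶜ, x l ^ c l) / (‖∏ l ∈ {i, j}ᶜ, x l ^ c l‖ : ℂ))) * hk'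

theorem coord_smul (Δ : CornerPolygon m) {i j : Fin (m + 2)}
    (h : latticeDet (Δ.normal i) (Δ.normal j) = 1) (k : Δ.K) (x : Δ.U) :
    Δ.coord i j (k • x).1 = Δ.coord i j x.1 := by
  have hij := ne_of_det h
  have h1 := Δ.prod_zpow_eq_one k (Δ.normal j)
  have h2 : ∏ l, k.1 l ^ latticeDet (Δ.normal i) (Δ.normal l) = 1 := by
    have : ∀ l, latticeDet (Δ.normal i) (Δ.normal l) = - latticeDet (Δ.normal l) (Δ.normal i) := by
      intro l; simp only [latticeDet]; ring
    simp only [this, zpow_neg, Finset.prod_inv_distrib, Δ.prod_zpow_eq_one k, inv_one]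
  have e : ∀ u, latticeDet u u = 0 := fun u => by simp only [latticeDet]; ring
  refine Prod.ext ?_ ?_
  · exact phase_smul h1 (by rw [Finset.prod_pair hij, h, e]; simp) x.1
  · exact phase_smul h2 (by rw [Finset.prod_pair hij, h, e]; simp) x.1

theorem prod_ne_zero {i j : Fin (m + 2)} {x : Fin (m + 2) → ℂ} (c : Fin (m + 2) → ℤ)
    (hx : ∀ l, l ≠ i → l ≠ j → x l ≠ 0) : ∏ l ∈ {i, j}ᶜ, x l ^ c l ≠ 0 :=
  Finset.prod_ne_zero_iff.2 fun l hl => by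
    simp only [Finset.mem_compl, Finset.mem_insert, Finset.mem_singleton, not_or] at hl
    exact zpow_ne_zero _ (hx l hl.1 hl.2)

theorem norm_phase {w : ℂ} (hw : w ≠ 0) : ‖w / (‖w‖ : ℂ)‖ = 1 := by
  rw [norm_div, Complex.norm_real, norm_norm, div_self (norm_ne_zero_iff.2 hw)]

theorem localSection_ne_zero (Δ : CornerPolygon m) {i j : Fin (m + 2)} {z : ℂ × ℂ}
    (hz : z ∈ Δ.chartTarget i j) (l : Fin (m + 2)) (hi : l ≠ i) (hj : l ≠ j) :
    Δ.localSection i j z l ≠ 0 := by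
  simp only [localSection, if_neg hi, if_neg hj]
  have := hz l hi hj
  exact_mod_cast (Real.sqrt_pos.2 (by linarith)).ne'

theorem coord_mem_target (Δ : CornerPolygon m) {i j : Fin (m + 2)}
    (h : latticeDet (Δ.normal i) (Δ.normal j) = 1) {x : Fin (m + 2) → ℂ} (hx : x ∈ Δ.U)
    (hx0 : ∀ l, l ≠ i → l ≠ j → x l ≠ 0) : Δ.coord i j x ∈ Δ.chartTarget i j := by
  intro l hi hj
  rw [Δ.height_eq h hx]
  · have := norm_pos_iff.2 (hx0 l hi hj)
    positivity
  · rw [coord, norm_mul, norm_phase (prod_ne_zero _ hx0), mul_one]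
  · rw [coord, norm_mul, norm_phase (prod_ne_zero _ hx0), mul_one]

theorem coord_localSection (Δ : CornerPolygon m) {i j : Fin (m + 2)}
    (h : latticeDet (Δ.normal i) (Δ.normal j) = 1) {z : ℂ × ℂ} (hz : z ∈ Δ.chartTarget i j) :
    Δ.coord i j (Δ.localSection i j z) = z := by
  have hij := ne_of_det h
  have key : ∀ c : Fin (m + 2) → ℤ,
      (∏ l ∈ {i, j}ᶜ, Δ.localSection i j z l ^ c l) /
        (‖∏ l ∈ {i, j}ᶜ, Δ.localSection i j z l ^ c l‖ : ℂ) = 1 := by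
    intro c
    have h0 := prod_ne_zero c (Δ.localSection_ne_zero hz)
    have : ∏ l ∈ {i, j}ᶜ, Δ.localSection i j z l ^ c l
        = ((∏ l ∈ {i, j}ᶜ, Real.sqrt (2 * Δ.height i j l z) ^ c l : ℝ) : ℂ) := by
      push_cast
      refine Finset.prod_congr rfl fun l hl => ?_
      simp only [Finset.mem_compl, Finset.mem_insert, Finset.mem_singleton, not_or] at hl
      simp only [localSection, if_neg hl.1, if_neg hl.2]
    rw [this] at h0 ⊢
    rw [Complex.norm_real, Real.norm_of_nonneg
      (Finset.prod_nonneg fun l _ => zpow_nonneg (Real.sqrt_nonneg _) _)]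
    exact div_self h0
  rw [coord, key, key]
  simp [localSection, hij.symm]

theorem phase_eq {i j : Fin (m + 2)} {x : Fin (m + 2) → ℂ} (hx : ∀ l, l ≠ i → l ≠ j → x l ≠ 0)
    (c : Fin (m + 2) → ℤ) :
    (∏ l ∈ {i, j}ᶜ, x l ^ c l) / (‖∏ l ∈ {i, j}ᶜ, x l ^ c l‖ : ℂ)
      = ((∏ l ∈ {i, j}ᶜ, Circle.exp (x l).arg ^ c l : Circle) : ℂ) := by
  have h0 := prod_ne_zero c hx
  rw [div_eq_iff (by exact_mod_cast norm_ne_zero_iff.2 h0), coe_prod, norm_prod]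
  push_cast
  rw [← Finset.prod_mul_distrib]
  refine Finset.prod_congr rfl fun l _ => ?_
  rw [norm_zpow, Complex.ofReal_zpow, ← mul_zpow, mul_comm]
  exact congrArg (· ^ c l) (Complex.norm_mul_exp_arg_mul_I _).symm

theorem proj_localSection_coord (Δ : CornerPolygon m) {i j : Fin (m + 2)}
    (h : latticeDet (Δ.normal i) (Δ.normal j) = 1) (x : Δ.U)
    (hx0 : ∀ l, l ≠ i → l ≠ j → x.1 l ≠ 0)
    (hs : Δ.localSection i j (Δ.coord i j x.1) ∈ Δ.U) :
    Δ.proj ⟨Δ.localSection i j (Δ.coord i j x.1), hs⟩ = Δ.proj x := by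
  have hij := ne_of_det h
  let p : Fin (m + 2) → Circle := fun l => Circle.exp (x.1 l).arg
  let c : Fin (m + 2) → ℤ := fun l => latticeDet (Δ.normal l) (Δ.normal j)
  let d : Fin (m + 2) → ℤ := fun l => latticeDet (Δ.normal i) (Δ.normal l)
  let k : Fin (m + 2) → Circle := fun l =>
    if l = i then ∏ l ∈ {i, j}ᶜ, p l ^ c l else if l = j then ∏ l ∈ {i, j}ᶜ, p l ^ d l
    else (p l)⁻¹
  have hki : k i = ∏ l ∈ {i, j}ᶜ, p l ^ c l := if_pos rfl
  have hkj : k j = ∏ l ∈ {i, j}ᶜ, p l ^ d l := by simp only [k, if_neg hij.symm, if_true]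
  have hkl : ∀ l, l ≠ i → l ≠ j → k l = (p l)⁻¹ := fun l h1 h2 => by
    simp only [k, if_neg h1, if_neg h2]
  have key : ∀ e : Fin (m + 2) → ℤ, (∀ l, e l = c l * e i + d l * e j) →
      ∏ l, k l ^ e l = 1 := by
    intro e he
    rw [← Finset.prod_mul_prod_compl {i, j}, Finset.prod_pair hij, hki, hkj,
      ← Finset.prod_zpow, ← Finset.prod_zpow, ← Finset.prod_mul_distrib,
      ← Finset.prod_mul_distrib]
    refine Finset.prod_eq_one fun l hl => ?_
    simp only [Finset.mem_compl, Finset.mem_insert, Finset.mem_singleton, not_or] at hl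
    rw [hkl l hl.1 hl.2, inv_zpow, ← zpow_mul, ← zpow_mul, ← zpow_add, ← he l, mul_inv_cancel]
  have hkK : k ∈ Δ.K := by
    rw [K, MonoidHom.mem_ker]
    refine Prod.ext (key _ fun l => ?_) (key _ fun l => ?_)
    · simp only [c, d, latticeDet] at h ⊢
      linear_combination (-(Δ.normal l).1) * h
    · simp only [c, d, latticeDet] at h ⊢
      linear_combination (-(Δ.normal l).2) * h
  refine Δ.proj_eq_proj.2 ⟨⟨k, hkK⟩, Subtype.ext (funext fun l => ?_)⟩
  rw [smul_apply]
  change (k l : ℂ) * x.1 l = Δ.localSection i j (Δ.coord i j x.1) l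
  by_cases hi : l = i
  · subst hi
    simp only [localSection, if_true, coord]
    rw [phase_eq hx0, hki, mul_comm]
  by_cases hj : l = j
  · subst hj
    simp only [localSection, if_true, if_neg hi, coord]
    rw [phase_eq hx0, hkj, mul_comm]
  simp only [localSection, if_neg hi, if_neg hj]
  rw [Δ.height_eq h x.2
    (by rw [coord, norm_mul, norm_phase (prod_ne_zero _ hx0), mul_one])
    (by rw [coord, norm_mul, norm_phase (prod_ne_zero _ hx0), mul_one]),
    show 2 * (1 / 2 * ‖x.1 l‖ ^ 2) = ‖x.1 l‖ ^ 2 by ring, Real.sqrt_sq (norm_nonneg _),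
    hkl l hi hj, Circle.coe_inv, inv_mul_eq_iff_eq_mul₀ (Circle.coe_ne_zero _), Circle.coe_exp,
    mul_comm, Complex.norm_mul_exp_arg_mul_I]

theorem mem_sphere (Δ : CornerPolygon m) (x : Δ.U) (l : Fin (m + 2)) :
    Δ.proj x ∈ Δ.sphere l ↔ x.1 l = 0 := by
  have h := Δ.norm_sq_of_mem_U x.2 l
  rw [← norm_eq_zero, ← sq_eq_zero_iff, h]
  simp only [sphere, momentMap, lift_proj, Set.mem_ofPred_eq, latticePairing]
  constructor <;> intro h' <;> linarith

theorem momentMap_mem_carrier (Δ : CornerPolygon m) (p : Δ.M) : Δ.momentMap p ∈ Δ.carrier := by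
  obtain ⟨x, rfl⟩ := Δ.proj_surjective p
  intro l
  have h := Δ.norm_sq_of_mem_U x.2 l
  have := sq_nonneg ‖x.1 l‖
  simp only [momentMap, lift_proj, latticePairing]
  linarith

theorem continuous_momentMap (Δ : CornerPolygon m) : Continuous Δ.momentMap :=
  Continuous.quotient_lift (f := fun x : Δ.U =>
    ((1 / 2 * ‖x.1 0‖ ^ 2, 1 / 2 * ‖x.1 (Fin.last (m + 1))‖ ^ 2) : ℝ × ℝ)) (by
      have h : ∀ l, Continuous fun x : Δ.U => x.1 l := fun l =>
        (continuous_apply l).comp continuous_subtype_val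
      exact (continuous_const.mul ((h 0).norm.pow 2)).prodMk
        (continuous_const.mul ((h _).norm.pow 2))) _

theorem nonempty_M (Δ : CornerPolygon m) : Nonempty Δ.M := by
  obtain ⟨w, ⟨-, hw⟩, -⟩ := Δ.edge_nontrivial 0
  refine ⟨Δ.proj ⟨fun l => (Real.sqrt (2 * (latticePairing w (Δ.normal l) - Δ.level l)) : ℂ),
    fun l _ _ => ?_⟩⟩
  simp only [Complex.norm_real, Real.norm_eq_abs, sq_abs]
  rw [Real.sq_sqrt (by have := hw 0; linarith), Real.sq_sqrt (by have := hw l; linarith),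
    Real.sq_sqrt (by have := hw (Fin.last (m + 1)); linarith)]
  simp only [latticePairing, Δ.normal_zero, Δ.normal_last, Δ.level_zero, Δ.level_last]
  push_cast
  ring

/-- The set of all `[x]` with `x_l ≠ 0` for `l ≠ i, j`. -/
def chartSource (Δ : CornerPolygon m) (i j : Fin (m + 2)) : Set Δ.M :=
  {p | ∀ l, l ≠ i → l ≠ j → p ∉ Δ.sphere l}

theorem proj_mem_chartSource (Δ : CornerPolygon m) (x : Δ.U) (i j : Fin (m + 2)) :
    Δ.proj x ∈ Δ.chartSource i j ↔ ∀ l, l ≠ i → l ≠ j → x.1 l ≠ 0 := by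
  simp only [chartSource, Set.mem_ofPred_eq, mem_sphere]

theorem contDiffAt_zpow {x : Fin (m + 2) → ℂ} {l : Fin (m + 2)} (hx : x l ≠ 0) (c : ℤ) :
    ContDiffAt ℝ ∞ (fun y : Fin (m + 2) → ℂ => y l ^ c) x := by
  have h1 : ContDiffAt ℝ ∞ (fun y : Fin (m + 2) → ℂ => y l) x := by fun_prop
  cases c with
  | ofNat n => simpa using h1.pow n
  | negSucc n =>
    simp only [zpow_negSucc]
    exact (h1.pow (n + 1)).inv (pow_ne_zero _ hx)

theorem contDiffAt_coord (Δ : CornerPolygon m) {i j : Fin (m + 2)} {x : Fin (m + 2) → ℂ}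
    (hx : ∀ l, l ≠ i → l ≠ j → x l ≠ 0) : ContDiffAt ℝ ∞ (Δ.coord i j) x := by
  have key : ∀ c : Fin (m + 2) → ℤ, ContDiffAt ℝ ∞ (fun y : Fin (m + 2) → ℂ =>
      (∏ l ∈ {i, j}ᶜ, y l ^ c l) / (‖∏ l ∈ {i, j}ᶜ, y l ^ c l‖ : ℂ)) x := by
    intro c
    have h1 : ContDiffAt ℝ ∞ (fun y : Fin (m + 2) → ℂ => ∏ l ∈ {i, j}ᶜ, y l ^ c l) x :=
      contDiffAt_prod fun l hl => by
        simp only [Finset.mem_compl, Finset.mem_insert, Finset.mem_singleton, not_or] at hl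
        exact contDiffAt_zpow (hx l hl.1 hl.2) _
    have h0 := prod_ne_zero c hx
    have h2 := Complex.ofRealCLM.contDiff.contDiffAt.comp x (h1.norm ℝ h0)
    simp only [div_eq_mul_inv]
    exact h1.mul (h2.inv (by
      change ((‖∏ l ∈ {i, j}ᶜ, x l ^ c l‖ : ℝ) : ℂ) ≠ 0
      exact_mod_cast norm_ne_zero_iff.2 h0))
  have hl : ∀ l, ContDiffAt ℝ ∞ (fun y : Fin (m + 2) → ℂ => y l) x := fun l => by fun_prop
  exact ((hl i).mul (key _)).prodMk ((hl j).mul (key _))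

theorem contDiff_height (Δ : CornerPolygon m) (i j l : Fin (m + 2)) :
    ContDiff ℝ ∞ (Δ.height i j l) := by
  have h1 : ContDiff ℝ ∞ (fun z : ℂ × ℂ => ‖z.1‖ ^ 2) := contDiff_fst.norm_sq ℝ
  have h2 : ContDiff ℝ ∞ (fun z : ℂ × ℂ => ‖z.2‖ ^ 2) := contDiff_snd.norm_sq ℝ
  unfold height
  fun_prop

theorem contDiffAt_localSection (Δ : CornerPolygon m) {i j : Fin (m + 2)} {z : ℂ × ℂ}
    (hz : z ∈ Δ.chartTarget i j) : ContDiffAt ℝ ∞ (Δ.localSection i j) z := by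
  refine contDiffAt_pi.2 fun l => ?_
  by_cases hi : l = i
  · simp only [localSection, if_pos hi]; fun_prop
  by_cases hj : l = j
  · simp only [localSection, if_neg hi, if_pos hj]; fun_prop
  simp only [localSection, if_neg hi, if_neg hj]
  have := hz l hi hj
  have h1 : ContDiffAt ℝ ∞ (fun z => 2 * Δ.height i j l z) z :=
    contDiffAt_const.mul (Δ.contDiff_height i j l).contDiffAt
  exact Complex.ofRealCLM.contDiff.contDiffAt.comp z (h1.sqrt (by linarith))

theorem isOpen_chartSource (Δ : CornerPolygon m) (i j : Fin (m + 2)) :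
    IsOpen (Δ.chartSource i j) := by
  simp only [chartSource, Set.ofPred_forall]
  refine isOpen_iInter_of_finite fun l => isOpen_iInter_of_finite fun _ =>
    isOpen_iInter_of_finite fun _ => ?_
  refine (isClosed_eq ?_ continuous_const).isOpen_compl
  have := Δ.continuous_momentMap
  unfold latticePairing
  fun_prop

open Classical in
/-- The chart of `M_Δ` defined by `v_i, v_j`; its inverse is `z ↦ [localSection z]`. -/
def chart (Δ : CornerPolygon m) (i j : Fin (m + 2))
    (h : latticeDet (Δ.normal i) (Δ.normal j) = 1) : OpenPartialHomeomorph Δ.M (ℂ × ℂ) where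
  toFun := Δ.lift (fun x => Δ.coord i j x.1) (Δ.coord_smul h)
  invFun z := if hz : z ∈ Δ.chartTarget i j then Δ.proj ⟨Δ.localSection i j z, Δ.localSection_mem h hz⟩
    else Classical.choice Δ.nonempty_M
  source := Δ.chartSource i j
  target := Δ.chartTarget i j
  map_source' p hp := by
    obtain ⟨x, rfl⟩ := Δ.proj_surjective p
    exact Δ.coord_mem_target h x.2 ((Δ.proj_mem_chartSource x i j).1 hp)
  map_target' z hz := by
    rw [dif_pos hz, proj_mem_chartSource]
    exact Δ.localSection_ne_zero hz
  left_inv' p hp := by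
    obtain ⟨x, rfl⟩ := Δ.proj_surjective p
    have hx := (Δ.proj_mem_chartSource x i j).1 hp
    rw [lift_proj, dif_pos (Δ.coord_mem_target h x.2 hx)]
    exact Δ.proj_localSection_coord h x hx _
  right_inv' z hz := by
    rw [dif_pos hz, lift_proj]
    exact Δ.coord_localSection h hz
  open_source := Δ.isOpen_chartSource i j
  open_target := by
    simp only [chartTarget, Set.ofPred_forall]
    refine isOpen_iInter_of_finite fun l => isOpen_iInter_of_finite fun _ =>
      isOpen_iInter_of_finite fun _ => ?_
    exact isOpen_lt continuous_const (Δ.contDiff_height i j l).continuous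
  continuousOn_toFun := by
    have h0 : IsOpen (Δ.chartSource i j) := Δ.isOpen_chartSource i j
    refine (Topology.IsQuotientMap.continuousOn_isOpen_iff
      (f := Δ.proj) isQuotientMap_quotient_mk' h0).2 ?_
    intro x hx
    have hx := (Δ.proj_mem_chartSource x i j).1 hx
    exact ((Δ.contDiffAt_coord hx).continuousAt.comp
      continuous_subtype_val.continuousAt).continuousWithinAt
  continuousOn_invFun := by
    refine continuousOn_iff_continuous_domRestrict.2 ?_
    have h1 : Continuous fun z : Δ.chartTarget i j =>
        Δ.proj ⟨Δ.localSection i j z.1, Δ.localSection_mem h z.2⟩ := by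
      refine Δ.continuous_proj.comp (Continuous.subtype_mk ?_ _)
      exact continuousOn_iff_continuous_domRestrict.1 fun z hz =>
        (Δ.contDiffAt_localSection hz).continuousAt.continuousWithinAt
    convert h1 using 1
    funext z
    exact dif_pos z.2

/-- Two edges of `Δ` that are not adjacent do not meet. -/
theorem not_mem_sphere (Δ : CornerPolygon m) {i k j : Fin (m + 2)} (hik : i < k) (hkj : k < j)
    {p : Δ.M} (hi : p ∈ Δ.sphere i) (hj : p ∈ Δ.sphere j) : False := by
  have h1 : (0 : ℝ) < latticeDet (Δ.normal i) (Δ.normal k) := by exact_mod_cast Δ.ccw _ _ hik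
  have h2 : (0 : ℝ) < latticeDet (Δ.normal k) (Δ.normal j) := by exact_mod_cast Δ.ccw _ _ hkj
  have h3 : (0 : ℝ) < latticeDet (Δ.normal i) (Δ.normal j) := by
    exact_mod_cast Δ.ccw _ _ (hik.trans hkj)
  have hk := Δ.momentMap_mem_carrier p k
  have hi : latticePairing (Δ.momentMap p) (Δ.normal i) = Δ.level i := hi
  have hj : latticePairing (Δ.momentMap p) (Δ.normal j) = Δ.level j := hj
  have rel : ∀ w : ℝ × ℝ, (latticeDet (Δ.normal i) (Δ.normal j) : ℝ) * latticePairing w (Δ.normal k)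
      = latticeDet (Δ.normal k) (Δ.normal j) * latticePairing w (Δ.normal i)
        + latticeDet (Δ.normal i) (Δ.normal k) * latticePairing w (Δ.normal j) := by
    intro w
    simp only [latticeDet, latticePairing]
    push_cast
    ring
  have key : ∀ y : ℝ × ℝ, latticePairing y (Δ.normal k) = Δ.level k →
      (∀ l, Δ.level l ≤ latticePairing y (Δ.normal l)) → y = Δ.momentMap p := by
    intro y hy hy'
    have e1 := rel y
    have e2 := rel (Δ.momentMap p)
    rw [hy] at e1
    rw [hi, hj] at e2
    have b1 := mul_le_mul_of_nonneg_left (hy' i) h2.le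
    have b2 := mul_le_mul_of_nonneg_left (hy' j) h1.le
    have b3 := mul_le_mul_of_nonneg_left hk h3.le
    have c1 : latticePairing y (Δ.normal i) = Δ.level i :=
      mul_left_cancel₀ h2.ne' (by linarith)
    have c2 : latticePairing y (Δ.normal j) = Δ.level j :=
      mul_left_cancel₀ h1.ne' (by linarith)
    rw [← hi] at c1
    rw [← hj] at c2
    simp only [latticeDet] at h3
    push_cast at h3
    simp only [latticePairing] at c1 c2
    refine Prod.ext (mul_left_cancel₀ h3.ne' ?_) (mul_left_cancel₀ h3.ne' ?_)
    · linear_combination ((Δ.normal j).2 : ℝ) * c1 - ((Δ.normal i).2 : ℝ) * c2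
    · linear_combination ((Δ.normal i).1 : ℝ) * c2 - ((Δ.normal j).1 : ℝ) * c1
  obtain ⟨y, ⟨hy, hy'⟩, z, ⟨hz, hz'⟩, hne⟩ := Δ.edge_nontrivial k
  exact hne ((key y hy hy').trans (key z hz hz').symm)

theorem det_succ (Δ : CornerPolygon m) (i : Fin (m + 1)) :
    latticeDet (Δ.normal i.castSucc) (Δ.normal i.succ) = 1 := by
  have h := Δ.ccw _ _ (Fin.castSucc_lt_succ (i := i))
  rcases Int.isUnit_iff.1 (Δ.delzant i) with h' | h' <;> omega

/-- The pairs `(i, j)` such that `v_i, v_j` is an oriented basis of `ℤ²`. -/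
def ChartIndex (Δ : CornerPolygon m) : Type :=
  {ij : Fin (m + 2) × Fin (m + 2) // latticeDet (Δ.normal ij.1) (Δ.normal ij.2) = 1}

theorem exists_chartIndex (Δ : CornerPolygon m) (p : Δ.M) :
    ∃ ij : Δ.ChartIndex, p ∈ Δ.chartSource ij.1.1 ij.1.2 := by
  by_cases hZ : ∃ l, p ∈ Δ.sphere l
  · classical
    obtain ⟨i, hi, hmin⟩ : ∃ i, p ∈ Δ.sphere i ∧ ∀ l, p ∈ Δ.sphere l → i ≤ l := by
      obtain ⟨l, hl⟩ := hZ
      obtain ⟨i, hi, hmin⟩ := (Set.toFinite {l | p ∈ Δ.sphere l}).exists_minimal ⟨l, hl⟩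
      exact ⟨i, hi, fun l hl => (le_total i l).elim id fun h => hmin hl h⟩
    induction i using Fin.lastCases with
    | last =>
      refine ⟨⟨(_, _), Δ.det_succ (Fin.last m)⟩, fun l h1 h2 hl => h2 ?_⟩
      exact Fin.last_le_iff.1 (hmin l hl)
    | cast i =>
      refine ⟨⟨(_, _), Δ.det_succ i⟩, fun l h1 h2 hl => ?_⟩
      have h3 : i.castSucc < l := lt_of_le_of_ne (hmin l hl) (Ne.symm h1)
      have h4 : i.succ < l := lt_of_le_of_ne (Fin.castSucc_lt_iff_succ_le.1 h3) (Ne.symm h2)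
      exact Δ.not_mem_sphere Fin.castSucc_lt_succ h4 hi hl
  · exact ⟨⟨(_, _), Δ.det_succ 0⟩, fun l _ _ hl => hZ ⟨l, hl⟩⟩

/-- A choice of a chart around `p`. -/
def chartIndexAt (Δ : CornerPolygon m) (p : Δ.M) : Δ.ChartIndex :=
  Classical.choose (Δ.exists_chartIndex p)

/-- The atlas of `M_Δ`: all charts given by oriented bases `v_i, v_j` of `ℤ²`. -/
instance (Δ : CornerPolygon m) : ChartedSpace (ℂ × ℂ) Δ.M where
  atlas := Set.range fun ij : Δ.ChartIndex => Δ.chart ij.1.1 ij.1.2 ij.2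
  chartAt := fun p => Δ.chart (Δ.chartIndexAt p).1.1 (Δ.chartIndexAt p).1.2 (Δ.chartIndexAt p).2
  mem_chart_source p := Classical.choose_spec (Δ.exists_chartIndex p)
  chart_mem_atlas _ := ⟨_, rfl⟩

theorem chart_symm_apply (Δ : CornerPolygon m) {i j : Fin (m + 2)}
    (h : latticeDet (Δ.normal i) (Δ.normal j) = 1) {z : ℂ × ℂ} (hz : z ∈ Δ.chartTarget i j) :
    (Δ.chart i j h).symm z = Δ.proj ⟨Δ.localSection i j z, Δ.localSection_mem h hz⟩ :=
  dif_pos hz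

/-- `M_Δ` is a smooth real four-dimensional manifold. -/
instance (Δ : CornerPolygon m) : IsManifold 𝓘(ℝ, ℂ × ℂ) ∞ Δ.M := by
  refine isManifold_of_contDiffOn _ _ _ ?_
  rintro _ _ ⟨⟨⟨i, j⟩, h⟩, rfl⟩ ⟨⟨⟨i', j'⟩, h'⟩, rfl⟩
  rintro z ⟨⟨hz, hz'⟩, -⟩
  replace hz : z ∈ Δ.chartTarget i j := hz
  replace hz' : (Δ.chart i j h).symm z ∈ Δ.chartSource i' j' := hz'
  rw [Δ.chart_symm_apply h hz, proj_mem_chartSource] at hz'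
  refine ContDiffAt.contDiffWithinAt ?_
  have h1 : ContDiffAt ℝ ∞ (Δ.coord i' j' ∘ Δ.localSection i j) z :=
    (Δ.contDiffAt_coord hz').comp z (Δ.contDiffAt_localSection hz)
  refine h1.congr_of_eventuallyEq ?_
  filter_upwards [(Δ.chart i j h).open_target.mem_nhds hz] with y hy
  change (Δ.chart i' j' h') ((Δ.chart i j h).symm y) = _
  rw [Δ.chart_symm_apply h hy]
  rfl

/-! ### The reduced symplectic form -/

/-- The standard symplectic form `ω₀ = ∑ dx_l ∧ dy_l` of `ℂⁿ`. -/
def stdForm (u v : Fin (m + 2) → ℂ) : ℝ := ∑ l, (conj (u l) * v l).im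

/-- The reduced symplectic form `ω_Δ`: the pullback of `ω₀` by a local section of `U_Δ → M_Δ`.
By `reducedForm_proj` it is the form whose pullback to `U_Δ` is the restriction of `ω₀`. -/
def reducedForm (Δ : CornerPolygon m) (p : Δ.M) (u v : TangentSpace 𝓘(ℝ, ℂ × ℂ) p) : ℝ :=
  stdForm
    (fderiv ℝ (Δ.localSection (Δ.chartIndexAt p).1.1 (Δ.chartIndexAt p).1.2)
      (chartAt (ℂ × ℂ) p p) u)
    (fderiv ℝ (Δ.localSection (Δ.chartIndexAt p).1.1 (Δ.chartIndexAt p).1.2)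
      (chartAt (ℂ × ℂ) p p) v)

/-- The tangent space of the level set `U_Δ` at `x`, i.e. the kernel of the differential of the
moment map. -/
def tangentU (Δ : CornerPolygon m) (x : Fin (m + 2) → ℂ) : Set (Fin (m + 2) → ℂ) :=
  {u | ∀ i, i ≠ 0 → i ≠ Fin.last (m + 1) →
    (Δ.normal i).1 * (conj (x 0) * u 0).re - (conj (x i) * u i).re
      + (Δ.normal i).2 * (conj (x (Fin.last (m + 1))) * u (Fin.last (m + 1))).re = 0}

theorem hasDerivAt_phase {P : ℝ → ℂ} {s : ℂ} (h0 : P 0 ≠ 0) (hP : HasDerivAt P (P 0 * s) 0) :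
    HasDerivAt (fun t => P t / (‖P t‖ : ℂ)) (P 0 / (‖P 0‖ : ℂ) * (Complex.I * s.im)) 0 := by
  have hn : ‖P 0‖ ≠ 0 := norm_ne_zero_iff.2 h0
  have hn' : ((‖P 0‖ : ℝ) : ℂ) ≠ 0 := by exact_mod_cast hn
  have h1 : HasDerivAt (fun t => ‖P t‖) (‖P 0‖ * s.re) 0 := by
    have h2 := (hP.norm_sq).sqrt (by positivity)
    simp only [Real.sqrt_sq (norm_nonneg _)] at h2
    convert h2 using 1
    have : inner ℝ (P 0) (P 0 * s) = ‖P 0‖ ^ 2 * s.re := by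
      rw [Complex.sq_norm, Complex.normSq_apply]
      simp [Complex.inner, Complex.mul_re, Complex.mul_im]
      ring
    rw [this]
    field_simp
  have h3 := hP.div (h1.ofReal_comp) hn'
  refine HasDerivAt.congr_deriv (f := fun t => P t / (‖P t‖ : ℂ)) h3 ?_
  have hs : s = s.re + s.im * Complex.I := (Complex.re_add_im s).symm
  rw [div_mul_eq_mul_div, div_eq_div_iff (pow_ne_zero 2 hn') hn']
  push_cast
  linear_combination ((‖P 0‖ : ℂ) ^ 2 * P 0) * hs

theorem hasDerivAt_prod {x u : Fin (m + 2) → ℂ} (c : Fin (m + 2) → ℤ) (s : Finset (Fin (m + 2)))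
    (hx : ∀ l ∈ s, x l ≠ 0) :
    HasDerivAt (fun t : ℝ => ∏ l ∈ s, (x l + t * u l) ^ c l)
      ((∏ l ∈ s, x l ^ c l) * ∑ l ∈ s, c l * (u l / x l)) 0 := by
  classical
  induction s using Finset.induction_on with
  | empty => simpa using hasDerivAt_const (0 : ℝ) (1 : ℂ)
  | insert a s ha ih =>
    have hxa := hx a (by simp)
    have h1 := ih fun l hl => hx l (by simp [hl])
    have h2 : HasDerivAt (fun t : ℝ => x a + t * u a) (u a) 0 := by
      simpa using ((Complex.ofRealCLM.hasDerivAt (x := (0 : ℝ))).mul_const (u a)).const_add (x a)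
    have h3 : HasDerivAt (fun t : ℝ => (x a + t * u a) ^ c a) (x a ^ c a * (c a * (u a / x a))) 0 := by
      have h4 := HasDerivAt.scomp_of_eq (0 : ℝ) (hasDerivAt_zpow (c a) (x a) (Or.inl hxa)) h2
        (by simp)
      refine HasDerivAt.congr_deriv (f := fun t : ℝ => (x a + t * u a) ^ c a) h4 ?_
      rw [smul_eq_mul, zpow_sub_one₀ hxa]
      field_simp
    simp only [Finset.prod_insert ha, Finset.sum_insert ha]
    refine HasDerivAt.congr_deriv (f := fun t : ℝ => (x a + t * u a) ^ c a *
      ∏ l ∈ s, (x l + t * u l) ^ c l) (h3.mul h1) ?_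
    simp only [Complex.ofReal_zero, zero_mul, add_zero]
    ring

/-- The logarithmic derivative of the phase `∏ (x_l / |x_l|) ^ c_l` in the direction `u`. -/
def phaseDeriv (i j : Fin (m + 2)) (c : Fin (m + 2) → ℤ) (x u : Fin (m + 2) → ℂ) : ℝ :=
  ∑ l ∈ {i, j}ᶜ, c l * (u l / x l).im

theorem hasDerivAt_coord_aux {i j : Fin (m + 2)} (a : Fin (m + 2)) (c : Fin (m + 2) → ℤ)
    {x : Fin (m + 2) → ℂ} (hx : ∀ l, l ≠ i → l ≠ j → x l ≠ 0) (u : Fin (m + 2) → ℂ) :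
    HasDerivAt (fun t : ℝ => (x a + t * u a) * ((∏ l ∈ {i, j}ᶜ, (x l + t * u l) ^ c l) /
        (‖∏ l ∈ {i, j}ᶜ, (x l + t * u l) ^ c l‖ : ℂ)))
      (((∏ l ∈ {i, j}ᶜ, x l ^ c l) / (‖∏ l ∈ {i, j}ᶜ, x l ^ c l‖ : ℂ)) *
        (u a + x a * (Complex.I * phaseDeriv i j c x u))) 0 := by
  have h0 := prod_ne_zero c hx
  have h1 := hasDerivAt_prod (x := x) (u := u) c {i, j}ᶜ fun l hl => by
    simp only [Finset.mem_compl, Finset.mem_insert, Finset.mem_singleton, not_or] at hl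
    exact hx l hl.1 hl.2
  have h2 : HasDerivAt (fun t : ℝ => x a + t * u a) (u a) 0 := by
    simpa using ((Complex.ofRealCLM.hasDerivAt (x := (0 : ℝ))).mul_const (u a)).const_add (x a)
  have h3 := hasDerivAt_phase (P := fun t : ℝ => ∏ l ∈ {i, j}ᶜ, (x l + t * u l) ^ c l)
    (s := ∑ l ∈ {i, j}ᶜ, c l * (u l / x l))
    (by simpa only [Complex.ofReal_zero, zero_mul, add_zero] using h0)
    (by simpa only [Complex.ofReal_zero, zero_mul, add_zero] using h1)
  refine HasDerivAt.congr_deriv (f := fun t : ℝ => (x a + t * u a) *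
    ((∏ l ∈ {i, j}ᶜ, (x l + t * u l) ^ c l) /
      (‖∏ l ∈ {i, j}ᶜ, (x l + t * u l) ^ c l‖ : ℂ))) (h2.mul h3) ?_
  have h4 : (∑ l ∈ {i, j}ᶜ, (c l : ℂ) * (u l / x l)).im = phaseDeriv i j c x u := by
    rw [phaseDeriv, Complex.im_sum]
    refine Finset.sum_congr rfl fun l _ => ?_
    rw [← Complex.ofReal_intCast, Complex.im_ofReal_mul]
  simp only [Complex.ofReal_zero, zero_mul, add_zero, h4]
  ring

theorem fderiv_coord (Δ : CornerPolygon m) {i j : Fin (m + 2)} {x : Fin (m + 2) → ℂ}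
    (hx : ∀ l, l ≠ i → l ≠ j → x l ≠ 0) (u : Fin (m + 2) → ℂ) :
    fderiv ℝ (Δ.coord i j) x u =
      (((∏ l ∈ {i, j}ᶜ, x l ^ latticeDet (Δ.normal l) (Δ.normal j)) /
        (‖∏ l ∈ {i, j}ᶜ, x l ^ latticeDet (Δ.normal l) (Δ.normal j)‖ : ℂ)) *
        (u i + x i * (Complex.I *
          phaseDeriv i j (fun l => latticeDet (Δ.normal l) (Δ.normal j)) x u)),
      ((∏ l ∈ {i, j}ᶜ, x l ^ latticeDet (Δ.normal i) (Δ.normal l)) /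
        (‖∏ l ∈ {i, j}ᶜ, x l ^ latticeDet (Δ.normal i) (Δ.normal l)‖ : ℂ)) *
        (u j + x j * (Complex.I *
          phaseDeriv i j (fun l => latticeDet (Δ.normal i) (Δ.normal l)) x u))) := by
  have h1 := ((Δ.contDiffAt_coord hx).differentiableAt (by simp)).hasFDerivAt
  have h2 : HasDerivAt (fun t : ℝ => x + t • u) u 0 := by
    simpa using ((hasDerivAt_id (0 : ℝ)).smul_const u).const_add x
  have h3 := HasFDerivAt.comp_hasDerivAt_of_eq (0 : ℝ) h1 h2 (by simp)
  exact h3.unique ((hasDerivAt_coord_aux i (fun l => latticeDet (Δ.normal l) (Δ.normal j)) hx u).prodMk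
    (hasDerivAt_coord_aux j (fun l => latticeDet (Δ.normal i) (Δ.normal l)) hx u))

/-- In each chart, the reduced form is the standard symplectic form of `ℂ²`. -/
theorem stdForm_fderiv_localSection (Δ : CornerPolygon m) {i j : Fin (m + 2)}
    (hij : i ≠ j) {z : ℂ × ℂ} (hz : z ∈ Δ.chartTarget i j) (u v : ℂ × ℂ) :
    stdForm (fderiv ℝ (Δ.localSection i j) z u) (fderiv ℝ (Δ.localSection i j) z v)
      = (conj u.1 * v.1).im + (conj u.2 * v.2).im := by
  have hd : ∀ l, DifferentiableAt ℝ (fun z => Δ.localSection i j z l) z := fun l =>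
    (contDiffAt_pi.1 (Δ.contDiffAt_localSection hz) l).differentiableAt (by simp)
  have hl : ∀ l w, fderiv ℝ (Δ.localSection i j) z w l
      = fderiv ℝ (fun z => Δ.localSection i j z l) z w := fun l w => by
    rw [show Δ.localSection i j = fun z l => Δ.localSection i j z l from rfl, fderiv_pi hd]
    rfl
  have e1 : ∀ w, fderiv ℝ (Δ.localSection i j) z w i = w.1 := fun w => by
    rw [hl]
    simp only [localSection, if_true]
    rw [fderiv_fst]
    rfl
  have e2 : ∀ w, fderiv ℝ (Δ.localSection i j) z w j = w.2 := fun w => by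
    rw [hl]
    simp only [localSection, if_true, if_neg hij.symm]
    rw [fderiv_snd]
    rfl
  have e3 : ∀ l ∈ ({i, j}ᶜ : Finset (Fin (m + 2))), ∀ w,
      (fderiv ℝ (Δ.localSection i j) z w l).im = 0 := fun l hl' w => by
    simp only [Finset.mem_compl, Finset.mem_insert, Finset.mem_singleton, not_or] at hl'
    rw [hl]
    have h1 := Complex.imCLM.hasFDerivAt.comp z (hd l).hasFDerivAt
    have h2 : (fun z => (Δ.localSection i j z l).im) = fun _ => 0 := by
      funext z
      simp only [localSection, if_neg hl'.1, if_neg hl'.2, Complex.ofReal_im]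
    have h3 : HasFDerivAt (fun z => (Δ.localSection i j z l).im) (0 : ℂ × ℂ →L[ℝ] ℝ) z := by
      rw [h2]
      exact hasFDerivAt_const _ _
    exact congrArg (fun f : ℂ × ℂ →L[ℝ] ℝ => f w) (h1.unique h3)
  rw [stdForm, ← Finset.sum_add_sum_compl {i, j}, Finset.sum_pair hij, e1, e1, e2, e2,
    Finset.sum_eq_zero (s := {i, j}ᶜ), add_zero]
  intro l hl'
  rw [Complex.mul_im, Complex.conj_im, e3 l hl', e3 l hl']
  ring

theorem tangentU_apply (Δ : CornerPolygon m) {x u : Fin (m + 2) → ℂ} (hu : u ∈ Δ.tangentU x)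
    (l : Fin (m + 2)) : (conj (x l) * u l).re = (Δ.normal l).1 * (conj (x 0) * u 0).re
      + (Δ.normal l).2 * (conj (x (Fin.last (m + 1))) * u (Fin.last (m + 1))).re := by
  by_cases h0 : l = 0
  · subst h0; simp only [Δ.normal_zero]; push_cast; ring
  by_cases h1 : l = Fin.last (m + 1)
  · subst h1; simp only [Δ.normal_last]; push_cast; ring
  have := hu l h0 h1
  linarith

theorem tangentU_chart (Δ : CornerPolygon m) {i j : Fin (m + 2)}
    (h : latticeDet (Δ.normal i) (Δ.normal j) = 1) {x u : Fin (m + 2) → ℂ}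
    (hu : u ∈ Δ.tangentU x) (l : Fin (m + 2)) :
    (conj (x l) * u l).re = latticeDet (Δ.normal l) (Δ.normal j) * (conj (x i) * u i).re
      + latticeDet (Δ.normal i) (Δ.normal l) * (conj (x j) * u j).re := by
  have h' : ((Δ.normal i).1 : ℝ) * (Δ.normal j).2 - (Δ.normal i).2 * (Δ.normal j).1 = 1 := by
    exact_mod_cast h
  rw [Δ.tangentU_apply hu l, Δ.tangentU_apply hu i, Δ.tangentU_apply hu j]
  simp only [latticeDet]
  push_cast
  linear_combination (-(((Δ.normal l).1 : ℝ) * (conj (x 0) * u 0).re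
    + (Δ.normal l).2 * (conj (x (Fin.last (m + 1))) * u (Fin.last (m + 1))).re)) * h'

theorem im_conj_mul {θ : ℂ} (hθ : ‖θ‖ = 1) (x u v : ℂ) (s t : ℝ) :
    (conj (θ * (u + x * (Complex.I * s))) * (θ * (v + x * (Complex.I * t)))).im
      = (conj u * v).im + (conj x * u).re * t - (conj x * v).re * s := by
  have h : conj θ * θ = 1 := by
    rw [← Complex.normSq_eq_conj_mul_self, Complex.normSq_eq_norm_sq, hθ]; simp
  have : conj (θ * (u + x * (Complex.I * s))) * (θ * (v + x * (Complex.I * t)))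
      = conj (u + x * (Complex.I * s)) * (v + x * (Complex.I * t)) := by
    rw [map_mul]
    linear_combination (conj (u + x * (Complex.I * s)) * (v + x * (Complex.I * t))) * h
  rw [this]
  simp only [map_add, map_mul, Complex.conj_I, Complex.conj_ofReal, Complex.mul_im, Complex.mul_re,
    Complex.add_im, Complex.add_re, Complex.conj_re, Complex.conj_im, Complex.neg_re,
    Complex.neg_im, Complex.I_re, Complex.I_im, Complex.ofReal_re, Complex.ofReal_im]
  ring

/-- The pullback of the reduced form to `U_Δ` is the restriction of `ω₀`. Here the differential of
`U_Δ → M_Δ` at `x` is the differential of the coordinates as functions of `x`. -/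
theorem reducedForm_proj (Δ : CornerPolygon m) (x : Δ.U) {u v : Fin (m + 2) → ℂ}
    (hu : u ∈ Δ.tangentU x.1) (hv : v ∈ Δ.tangentU x.1) :
    Δ.reducedForm (Δ.proj x)
      (fderiv ℝ (Δ.coord (Δ.chartIndexAt (Δ.proj x)).1.1 (Δ.chartIndexAt (Δ.proj x)).1.2) x.1 u)
      (fderiv ℝ (Δ.coord (Δ.chartIndexAt (Δ.proj x)).1.1 (Δ.chartIndexAt (Δ.proj x)).1.2) x.1 v)
      = stdForm u v := by
  have hs : Δ.proj x ∈ Δ.chartSource (Δ.chartIndexAt (Δ.proj x)).1.1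
      (Δ.chartIndexAt (Δ.proj x)).1.2 := Classical.choose_spec (Δ.exists_chartIndex _)
  unfold reducedForm
  change stdForm (fderiv ℝ _ (Δ.coord _ _ x.1) _) (fderiv ℝ _ (Δ.coord _ _ x.1) _) = _
  generalize Δ.chartIndexAt (Δ.proj x) = ij at hs ⊢
  obtain ⟨⟨i, j⟩, h⟩ := ij
  have hx := (Δ.proj_mem_chartSource x i j).1 hs
  dsimp only at h ⊢
  have hij := ne_of_det h
  rw [Δ.stdForm_fderiv_localSection hij (Δ.coord_mem_target h x.2 hx), Δ.fderiv_coord hx,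
    Δ.fderiv_coord hx]
  dsimp only
  rw [im_conj_mul (norm_phase (prod_ne_zero _ hx)), im_conj_mul (norm_phase (prod_ne_zero _ hx)),
    stdForm, ← Finset.sum_add_sum_compl {i, j}, Finset.sum_pair hij]
  have key : ∑ l ∈ {i, j}ᶜ, (conj (u l) * v l).im
      = (conj (x.1 i) * u i).re * phaseDeriv i j (fun l => latticeDet (Δ.normal l) (Δ.normal j)) x.1 v
      + (conj (x.1 j) * u j).re * phaseDeriv i j (fun l => latticeDet (Δ.normal i) (Δ.normal l)) x.1 v
      - (conj (x.1 i) * v i).re * phaseDeriv i j (fun l => latticeDet (Δ.normal l) (Δ.normal j)) x.1 u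
      - (conj (x.1 j) * v j).re *
        phaseDeriv i j (fun l => latticeDet (Δ.normal i) (Δ.normal l)) x.1 u := by
    simp only [phaseDeriv, Finset.mul_sum, ← Finset.sum_add_distrib, ← Finset.sum_sub_distrib]
    refine Finset.sum_congr rfl fun l hl => ?_
    simp only [Finset.mem_compl, Finset.mem_insert, Finset.mem_singleton, not_or] at hl
    have hu' := Δ.tangentU_chart h hu l
    have hv' := Δ.tangentU_chart h hv l
    have hne := hx l hl.1 hl.2
    have hU : u l = u l / x.1 l * x.1 l := (div_mul_cancel₀ _ hne).symm
    have hV : v l = v l / x.1 l * x.1 l := (div_mul_cancel₀ _ hne).symm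
    have e : (conj (u l) * v l).im = (conj (x.1 l) * u l).re * (v l / x.1 l).im
        - (conj (x.1 l) * v l).re * (u l / x.1 l).im := by
      generalize u l / x.1 l = a at hU ⊢
      generalize v l / x.1 l = b at hV ⊢
      rw [hU, hV]
      simp only [map_mul, Complex.mul_im, Complex.mul_re, Complex.conj_re, Complex.conj_im]
      ring
    rw [e, hu', hv']
    ring
  rw [key]
  ring

/-! ### The symplectic blowup map -/

/-- The symplectic blowup map `ψ`, defined on `M_Δ ∖ D`; see `blowupMap_source`,
`blowupMap_target` and `blowupMap_proj`. -/
def blowupMap (Δ : CornerPolygon m) : OpenPartialHomeomorph Δ.M (ℂ × ℂ) :=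
  Δ.chart 0 (Fin.last (m + 1)) (by simp [latticeDet, Δ.normal_zero, Δ.normal_last])

theorem blowupMap_source (Δ : CornerPolygon m) : Δ.blowupMap.source = Δ.chainᶜ := by
  ext p
  change p ∈ Δ.chartSource _ _ ↔ _
  simp [chartSource, chain]

theorem blowupMap_target (Δ : CornerPolygon m) : Δ.blowupMap.target =
    {z | ∀ l, l ≠ 0 → l ≠ Fin.last (m + 1) →
      Δ.level l < 1 / 2 * latticePairing (‖z.1‖ ^ 2, ‖z.2‖ ^ 2) (Δ.normal l)} := by
  ext z
  change z ∈ Δ.chartTarget _ _ ↔ _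
  simp only [chartTarget, height, latticeDet, latticePairing, Δ.normal_zero, Δ.normal_last,
    Δ.level_zero, Δ.level_last, Set.mem_ofPred_eq]
  refine forall_congr' fun l => forall_congr' fun _ => forall_congr' fun _ => ?_
  push_cast
  constructor <;> intro h <;> linarith

theorem blowupMap_proj (Δ : CornerPolygon m) (x : Δ.U) : Δ.blowupMap (Δ.proj x) =
    (x.1 0 * ((∏ l ∈ {0, Fin.last (m + 1)}ᶜ, x.1 l ^ (Δ.normal l).1) /
        (‖∏ l ∈ {0, Fin.last (m + 1)}ᶜ, x.1 l ^ (Δ.normal l).1‖ : ℂ)),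
      x.1 (Fin.last (m + 1)) * ((∏ l ∈ {0, Fin.last (m + 1)}ᶜ, x.1 l ^ (Δ.normal l).2) /
        (‖∏ l ∈ {0, Fin.last (m + 1)}ᶜ, x.1 l ^ (Δ.normal l).2‖ : ℂ))) := by
  change Δ.coord _ _ x.1 = _
  simp [coord, latticeDet, Δ.normal_zero, Δ.normal_last]

end

end CornerPolygon

/-- The map `(x₁, …, x_n) ↦ (-x̄_n, x̄_{n-1}, …, x̄₁)` of `ℂⁿ`. -/
noncomputable def flipMap {m : ℕ} (x : Fin (m + 2) → ℂ) : Fin (m + 2) → ℂ :=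
  fun i => if i = 0 then -conj (x (Fin.last (m + 1))) else conj (x i.rev)

/-!
The flip `x ↦ (-x̄_n, x̄_{n-1}, …, x̄₁)` is a real linear automorphism of `ℂⁿ` that reverses the
order of the norms of the coordinates, so it carries the level set `U_Δ` onto that of the mirror.
It conjugates the action of `k ∈ K_Δ` to that of `l ↦ k_{n+1-l}⁻¹`, which lies in the group of the
mirror; hence it descends to a bijection `F` of the reduced spaces.

Any map of reduced spaces that is induced by a real linear map `L` reads, in charts, as
`coord ∘ L ∘ localSection`. This gives the smoothness of `F` and of its inverse
(`contMDiff_of_induced`), and shows that the differential of `F` is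
`d coord ∘ L ∘ d localSection` (`mfderiv_of_induced`). Since a local section takes values in `U_Δ`,
its differential takes values in the tangent spaces of `U_Δ`, and `reducedForm_proj` reduces the
statement on symplectic forms to `ω₀ (flip u) (flip v) = -ω₀ u v`, which holds because the flip is
antiunitary. The remaining properties can be read off on representatives.
-/

open CornerPolygon

/-! ### The flip of `ℂⁿ` -/

section Flip

variable {m : ℕ}

theorem flipMap_zero (x : Fin (m + 2) → ℂ) : flipMap x 0 = -conj (x (Fin.last (m + 1))) :=
  if_pos rfl

theorem flipMap_of_ne_zero (x : Fin (m + 2) → ℂ) {i : Fin (m + 2)} (hi : i ≠ 0) :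
    flipMap x i = conj (x i.rev) :=
  if_neg hi

theorem flipMap_last (x : Fin (m + 2) → ℂ) : flipMap x (Fin.last (m + 1)) = conj (x 0) := by
  rw [flipMap_of_ne_zero x (Fin.last_pos (n := m)).ne', Fin.rev_last]

theorem norm_flipMap (x : Fin (m + 2) → ℂ) (i : Fin (m + 2)) : ‖flipMap x i‖ = ‖x i.rev‖ := by
  by_cases hi : i = 0
  · subst hi; rw [flipMap_zero, norm_neg, RCLike.norm_conj, Fin.rev_zero]
  · rw [flipMap_of_ne_zero x hi, RCLike.norm_conj]

theorem flipMap_eq_zero_iff (x : Fin (m + 2) → ℂ) (i : Fin (m + 2)) :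
    flipMap x i = 0 ↔ x i.rev = 0 := by
  rw [← norm_eq_zero, norm_flipMap, norm_eq_zero]

/-- The signs in the flip cancel in hermitian products. -/
theorem conj_flipMap_mul_flipMap (x u : Fin (m + 2) → ℂ) (i : Fin (m + 2)) :
    conj (flipMap x i) * flipMap u i = conj (conj (x i.rev) * u i.rev) := by
  by_cases hi : i = 0
  · subst hi; rw [flipMap_zero, flipMap_zero, Fin.rev_zero]; simp
  · rw [flipMap_of_ne_zero x hi, flipMap_of_ne_zero u hi, map_mul]

theorem stdForm_flipMap (u v : Fin (m + 2) → ℂ) :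
    stdForm (flipMap u) (flipMap v) = -stdForm u v := by
  simp only [stdForm, conj_flipMap_mul_flipMap, Complex.conj_im, Finset.sum_neg_distrib]
  exact congrArg Neg.neg (Equiv.sum_comp Fin.revPerm fun l => (conj (u l) * v l).im)

/-- The flip as a real linear automorphism of `ℂⁿ`. -/
noncomputable def flipEquiv (m : ℕ) : (Fin (m + 2) → ℂ) ≃L[ℝ] (Fin (m + 2) → ℂ) :=
  LinearEquiv.toContinuousLinearEquiv
    { toFun := flipMap
      invFun := fun y i => if i = Fin.last (m + 1) then -conj (y 0) else conj (y i.rev)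
      map_add' := fun x y => by
        funext i
        by_cases hi : i = 0
        · subst hi; simp [flipMap_zero, add_comm]
        · simp [flipMap_of_ne_zero _ hi]
      map_smul' := fun c x => by
        funext i
        by_cases hi : i = 0
        · subst hi; simp [flipMap_zero]
        · simp [flipMap_of_ne_zero _ hi]
      left_inv := fun x => by
        funext i
        by_cases hi : i = Fin.last (m + 1)
        · subst hi; simp [flipMap_zero]
        · have : i.rev ≠ 0 := fun h => hi (by rw [← Fin.rev_rev i, h, Fin.rev_zero])
          simp [hi, flipMap_of_ne_zero _ this]
      right_inv := fun y => by
        funext i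
        by_cases hi : i = 0
        · subst hi; simp [flipMap_zero]
        · have : i.rev ≠ Fin.last (m + 1) := fun h => hi (by rw [← Fin.rev_rev i, h, Fin.rev_last])
          simp [this, flipMap_of_ne_zero _ hi] }

theorem flipMap_flipEquiv_symm (y : Fin (m + 2) → ℂ) : flipMap ((flipEquiv m).symm y) = y :=
  (flipEquiv m).apply_symm_apply y

end Flip

/-! ### Maps of reduced spaces induced by linear maps -/

section Induced

variable {m m' : ℕ} {Δ : CornerPolygon m} {Δ' : CornerPolygon m'}
  {L : (Fin (m + 2) → ℂ) →L[ℝ] (Fin (m' + 2) → ℂ)} {hL : ∀ x ∈ Δ.U, L x ∈ Δ'.U} {f : Δ.M → Δ'.M}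

theorem continuous_of_induced (hf : ∀ x : Δ.U, f (Δ.proj x) = Δ'.proj ⟨L x.1, hL x.1 x.2⟩) :
    Continuous f := by
  refine (isQuotientMap_quotient_mk' (s := MulAction.orbitRel Δ.K Δ.U)).continuous_iff.2 ?_
  have : Continuous fun x : Δ.U => Δ'.proj ⟨L x.1, hL x.1 x.2⟩ :=
    Δ'.continuous_proj.comp
      (Continuous.subtype_mk (L.continuous.comp continuous_subtype_val) fun x => hL x.1 x.2)
  exact this.congr fun x => (hf x).symm

/-- The representative of `p` on the section that belongs to the chart at `p`. -/
theorem proj_localSection_chartAt (Δ : CornerPolygon m) (p : Δ.M) :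
    ∃ h : chartAt (ℂ × ℂ) p p ∈ Δ.chartTarget (Δ.chartIndexAt p).1.1 (Δ.chartIndexAt p).1.2,
      Δ.proj ⟨Δ.localSection (Δ.chartIndexAt p).1.1 (Δ.chartIndexAt p).1.2 (chartAt (ℂ × ℂ) p p),
        Δ.localSection_mem (Δ.chartIndexAt p).2 h⟩ = p := by
  have h := (chartAt (ℂ × ℂ) p).map_source (mem_chart_source (ℂ × ℂ) p)
  refine ⟨h, ?_⟩
  rw [← Δ.chart_symm_apply (Δ.chartIndexAt p).2 h]
  exact (chartAt (ℂ × ℂ) p).left_inv (mem_chart_source (ℂ × ℂ) p)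

/-- In the charts at `p` and `f p`, the induced map is `coord ∘ L ∘ localSection`. -/
theorem writtenInExtChartAt_of_induced
    (hf : ∀ x : Δ.U, f (Δ.proj x) = Δ'.proj ⟨L x.1, hL x.1 x.2⟩) (p : Δ.M) :
    writtenInExtChartAt 𝓘(ℝ, ℂ × ℂ) 𝓘(ℝ, ℂ × ℂ) p f =ᶠ[nhds (chartAt (ℂ × ℂ) p p)]
      Δ'.coord (Δ'.chartIndexAt (f p)).1.1 (Δ'.chartIndexAt (f p)).1.2 ∘ L ∘
        Δ.localSection (Δ.chartIndexAt p).1.1 (Δ.chartIndexAt p).1.2 := by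
  filter_upwards [(chartAt (ℂ × ℂ) p).open_target.mem_nhds
    ((chartAt (ℂ × ℂ) p).map_source (mem_chart_source (ℂ × ℂ) p))] with y hy
  change (chartAt (ℂ × ℂ) (f p)) (f ((chartAt (ℂ × ℂ) p).symm y)) = _
  have h1 : (chartAt (ℂ × ℂ) p).symm y = Δ.proj ⟨Δ.localSection (Δ.chartIndexAt p).1.1
      (Δ.chartIndexAt p).1.2 y, Δ.localSection_mem (Δ.chartIndexAt p).2 hy⟩ :=
    Δ.chart_symm_apply (Δ.chartIndexAt p).2 hy
  rw [h1, hf]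
  rfl

/-- The image under `L` of the representative of `p` on the section lies where the coordinates of
the chart at `f p` are smooth. -/
theorem induced_localSection_ne_zero
    (hf : ∀ x : Δ.U, f (Δ.proj x) = Δ'.proj ⟨L x.1, hL x.1 x.2⟩) (p : Δ.M) :
    ∀ l, l ≠ (Δ'.chartIndexAt (f p)).1.1 → l ≠ (Δ'.chartIndexAt (f p)).1.2 →
      L (Δ.localSection (Δ.chartIndexAt p).1.1 (Δ.chartIndexAt p).1.2
        (chartAt (ℂ × ℂ) p p)) l ≠ 0 := by
  obtain ⟨h, hp⟩ := proj_localSection_chartAt Δ p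
  have h1 := mem_chart_source (ℂ × ℂ) (f p)
  -- the chart is generalized before `f p` is rewritten, since its choice depends on `f p`
  change f p ∈ Δ'.chartSource (Δ'.chartIndexAt (f p)).1.1 (Δ'.chartIndexAt (f p)).1.2 at h1
  generalize Δ'.chartIndexAt (f p) = ij at h1 ⊢
  rw [← hp, hf, proj_mem_chartSource] at h1
  exact h1

theorem contMDiff_of_induced
    (hf : ∀ x : Δ.U, f (Δ.proj x) = Δ'.proj ⟨L x.1, hL x.1 x.2⟩) :
    ContMDiff 𝓘(ℝ, ℂ × ℂ) 𝓘(ℝ, ℂ × ℂ) ∞ f := by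
  intro p
  refine contMDiffAt_iff.2 ⟨(continuous_of_induced hf).continuousAt, ContDiffAt.contDiffWithinAt ?_⟩
  obtain ⟨h, -⟩ := proj_localSection_chartAt Δ p
  have h1 := (Δ'.contDiffAt_coord (induced_localSection_ne_zero hf p)).comp
    (chartAt (ℂ × ℂ) p p) (L.contDiff.contDiffAt.comp (chartAt (ℂ × ℂ) p p) (Δ.contDiffAt_localSection h))
  exact h1.congr_of_eventuallyEq (writtenInExtChartAt_of_induced hf p)

theorem mfderiv_of_induced
    (hf : ∀ x : Δ.U, f (Δ.proj x) = Δ'.proj ⟨L x.1, hL x.1 x.2⟩) (p : Δ.M)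
    (u : TangentSpace 𝓘(ℝ, ℂ × ℂ) p) :
    mfderiv 𝓘(ℝ, ℂ × ℂ) 𝓘(ℝ, ℂ × ℂ) f p u =
      fderiv ℝ (Δ'.coord (Δ'.chartIndexAt (f p)).1.1 (Δ'.chartIndexAt (f p)).1.2)
        (L (Δ.localSection (Δ.chartIndexAt p).1.1 (Δ.chartIndexAt p).1.2 (chartAt (ℂ × ℂ) p p)))
        (L (fderiv ℝ (Δ.localSection (Δ.chartIndexAt p).1.1 (Δ.chartIndexAt p).1.2)
          (chartAt (ℂ × ℂ) p p) u)) := by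
  obtain ⟨h, -⟩ := proj_localSection_chartAt Δ p
  have h1 := ((Δ'.contDiffAt_coord (induced_localSection_ne_zero hf p)).differentiableAt
    (by simp)).hasFDerivAt
  have h2 := ((Δ.contDiffAt_localSection h).differentiableAt (by simp)).hasFDerivAt
  have h3 := (h1.comp (chartAt (ℂ × ℂ) p p) (L.hasFDerivAt.comp (chartAt (ℂ × ℂ) p p) h2)).congr_of_eventuallyEq
    (writtenInExtChartAt_of_induced hf p)
  rw [((contMDiff_of_induced hf p).mdifferentiableAt (by simp)).mfderiv]
  rw [ModelWithCorners.range_eq_univ, fderivWithin_univ]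
  exact congrArg (fun A : ℂ × ℂ →L[ℝ] ℂ × ℂ => A u) h3.fderiv

/-- Local sections take values in `U_Δ`, so their differentials take values in its tangent
spaces. -/
theorem CornerPolygon.fderiv_localSection_mem_tangentU (Δ : CornerPolygon m) {i j : Fin (m + 2)}
    (h : latticeDet (Δ.normal i) (Δ.normal j) = 1) {z : ℂ × ℂ} (hz : z ∈ Δ.chartTarget i j)
    (u : ℂ × ℂ) : fderiv ℝ (Δ.localSection i j) z u ∈ Δ.tangentU (Δ.localSection i j z) := by
  intro l h0 h1
  have hd := ((Δ.contDiffAt_localSection hz).differentiableAt (by simp)).hasFDerivAt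
  have hc : ∀ a, HasFDerivAt (fun y => Δ.localSection i j y a)
      ((ContinuousLinearMap.proj a).comp (fderiv ℝ (Δ.localSection i j) z)) z := fun a =>
    hasFDerivAt_pi'.1 hd a
  have hn := fun a => (hc a).norm_sq
  -- differentiate the equation that defines `U_Δ`, which holds on the open set `chartTarget`
  have h2 := ((((hn 0).const_mul ((Δ.normal l).1 : ℝ)).sub (hn l)).add
    ((hn (Fin.last (m + 1))).const_mul ((Δ.normal l).2 : ℝ))).const_mul (1 / 2 : ℝ)
  have h3 := (hasFDerivAt_const (𝕜 := ℝ) (Δ.level l) z).congr_of_eventuallyEq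
    (f₁ := fun y => (1 / 2 : ℝ) * ((Δ.normal l).1 * ‖Δ.localSection i j y 0‖ ^ 2
      - ‖Δ.localSection i j y l‖ ^ 2
      + (Δ.normal l).2 * ‖Δ.localSection i j y (Fin.last (m + 1))‖ ^ 2)) (by
      filter_upwards [(Δ.chart i j h).open_target.mem_nhds hz] with y hy
      exact Δ.localSection_mem h hy l h0 h1)
  have h4 := congrArg (fun A : ℂ × ℂ →L[ℝ] ℝ => A u) (h2.unique h3)
  simp [Complex.inner] at h4
  simp only [Complex.mul_re, Complex.conj_re, Complex.conj_im]
  linarith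

end Induced

/-! ### The induced map of the reduced spaces -/

namespace CornerPolygon

variable {m : ℕ} (Δ : CornerPolygon m)

theorem flipMap_mem_mirror_U_iff {x : Fin (m + 2) → ℂ} : flipMap x ∈ Δ.mirror.U ↔ x ∈ Δ.U := by
  constructor
  · intro h i h0 h1
    have := Δ.mirror.norm_sq_of_mem_U h i.rev
    simp only [norm_flipMap, mirror, Fin.rev_rev, Fin.rev_zero, Fin.rev_last, Prod.fst_swap,
      Prod.snd_swap] at this
    linarith
  · intro h i h0 h1
    have := Δ.norm_sq_of_mem_U h i.rev
    simp only [norm_flipMap, mirror, Fin.rev_zero, Fin.rev_last, Prod.fst_swap, Prod.snd_swap]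
    linarith

theorem flipEquiv_symm_mem_U {y : Fin (m + 2) → ℂ} (hy : y ∈ Δ.mirror.U) :
    (flipEquiv m).symm y ∈ Δ.U := by
  rw [← flipMap_mem_mirror_U_iff, flipMap_flipEquiv_symm]
  exact hy

theorem flipMap_mem_mirror_tangentU {x u : Fin (m + 2) → ℂ} (hu : u ∈ Δ.tangentU x) :
    flipMap u ∈ Δ.mirror.tangentU (flipMap x) := by
  intro i h0 h1
  have := Δ.tangentU_apply hu i.rev
  simp only [conj_flipMap_mul_flipMap, Complex.conj_re, mirror, Fin.rev_zero, Fin.rev_last,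
    Prod.fst_swap, Prod.snd_swap]
  linarith

/-- The flip conjugates the action of `k` to that of `l ↦ k_{n+1-l}⁻¹`; see `flipMap_mul`. -/
theorem mem_mirror_K_iff {k : Fin (m + 2) → Circle} :
    (fun l => (k l.rev)⁻¹) ∈ Δ.mirror.K ↔ k ∈ Δ.K := by
  have e : ∀ c : Fin (m + 2) → ℤ,
      ∏ l : Fin (m + 2), (k l.rev)⁻¹ ^ c l.rev = (∏ l, k l ^ c l)⁻¹ := by
    intro c
    simp only [inv_zpow, Finset.prod_inv_distrib]
    exact congrArg Inv.inv (Equiv.prod_comp Fin.revPerm fun l => k l ^ c l)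
  have h : Δ.mirror.torusHom (fun l => (k l.rev)⁻¹) = (Δ.torusHom k).swap⁻¹ :=
    Prod.ext (e fun l => (Δ.normal l).2) (e fun l => (Δ.normal l).1)
  rw [K, K, MonoidHom.mem_ker, MonoidHom.mem_ker, h, inv_eq_one]
  exact Prod.swap_injective.eq_iff' rfl

theorem flipMap_mul (k : Fin (m + 2) → Circle) (x : Fin (m + 2) → ℂ) (l : Fin (m + 2)) :
    flipMap (fun l => (k l : ℂ) * x l) l = ((k l.rev)⁻¹ : Circle) * flipMap x l := by
  rw [Circle.coe_inv_eq_conj]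
  by_cases hl : l = 0
  · subst hl; rw [flipMap_zero, flipMap_zero, map_mul, Fin.rev_zero, mul_neg]
  · rw [flipMap_of_ne_zero _ hl, flipMap_of_ne_zero _ hl, map_mul]

/-- The flip as a bijection of the level sets. -/
noncomputable def flipU : Δ.U ≃ Δ.mirror.U :=
  (flipEquiv m).toEquiv.subtypeEquiv fun _ => Δ.flipMap_mem_mirror_U_iff.symm

theorem proj_flipU_eq_iff (x y : Δ.U) :
    Δ.mirror.proj (Δ.flipU x) = Δ.mirror.proj (Δ.flipU y) ↔ Δ.proj x = Δ.proj y := by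
  rw [proj_eq_proj, proj_eq_proj]
  constructor
  · rintro ⟨k, hk⟩
    have hk' : (fun l => (k.1 l.rev)⁻¹) ∈ Δ.K := by
      rw [← mem_mirror_K_iff]
      simp only [Fin.rev_rev, inv_inv]
      exact k.2
    refine ⟨⟨_, hk'⟩, Δ.flipU.injective ?_⟩
    rw [← hk]
    refine Subtype.ext (funext fun l => (flipMap_mul _ y.1 l).trans ?_)
    simp only [Fin.rev_rev, inv_inv]
    rfl
  · rintro ⟨k, rfl⟩
    exact ⟨⟨_, Δ.mem_mirror_K_iff.2 k.2⟩, Subtype.ext (funext fun l => (flipMap_mul _ y.1 l).symm)⟩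

/-- The bijection `F` of the reduced spaces induced by the flip. -/
noncomputable def flipM : Δ.M ≃ Δ.mirror.M :=
  Quotient.congr Δ.flipU fun x y =>
    Quotient.eq.symm.trans ((Δ.proj_flipU_eq_iff x y).symm.trans Quotient.eq)

theorem flipM_proj (x : Δ.U) :
    Δ.flipM (Δ.proj x) = Δ.mirror.proj ⟨flipMap x.1, Δ.flipMap_mem_mirror_U_iff.2 x.2⟩ := rfl

theorem flipM_symm_proj (y : Δ.mirror.U) :
    Δ.flipM.symm (Δ.mirror.proj y) =
      Δ.proj ⟨(flipEquiv m).symm y.1, Δ.flipEquiv_symm_mem_U y.2⟩ := by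
  rw [Equiv.symm_apply_eq, flipM_proj]
  congr 1
  exact Subtype.ext (flipMap_flipEquiv_symm y.1).symm

/-- `F` as a diffeomorphism. -/
noncomputable def flipDiffeomorph : Diffeomorph 𝓘(ℝ, ℂ × ℂ) 𝓘(ℝ, ℂ × ℂ) Δ.M Δ.mirror.M ∞ where
  toEquiv := Δ.flipM
  contMDiff_toFun := contMDiff_of_induced (f := Δ.flipM)
    (L := (flipEquiv m).toContinuousLinearMap)
    (hL := fun _ h => Δ.flipMap_mem_mirror_U_iff.2 h) Δ.flipM_proj
  contMDiff_invFun := contMDiff_of_induced (f := Δ.flipM.symm)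
    (L := (flipEquiv m).symm.toContinuousLinearMap)
    (hL := fun _ h => Δ.flipEquiv_symm_mem_U h) Δ.flipM_symm_proj

theorem flipDiffeomorph_proj (x : Δ.U) : Δ.flipDiffeomorph (Δ.proj x) =
    Δ.mirror.proj ⟨flipMap x.1, Δ.flipMap_mem_mirror_U_iff.2 x.2⟩ := rfl

/-- `F` is antisymplectic: both forms are computed upstairs, by `ω₀` on the differential of a local
section and on its image under the flip. -/
theorem reducedForm_flipDiffeomorph (p : Δ.M) (u v : TangentSpace 𝓘(ℝ, ℂ × ℂ) p) :
    Δ.mirror.reducedForm (Δ.flipDiffeomorph p)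
      (mfderiv 𝓘(ℝ, ℂ × ℂ) 𝓘(ℝ, ℂ × ℂ) Δ.flipDiffeomorph p u)
      (mfderiv 𝓘(ℝ, ℂ × ℂ) 𝓘(ℝ, ℂ × ℂ) Δ.flipDiffeomorph p v) = -Δ.reducedForm p u v := by
  have hmf := mfderiv_of_induced (f := Δ.flipDiffeomorph) (L := (flipEquiv m).toContinuousLinearMap)
    (hL := fun _ h => Δ.flipMap_mem_mirror_U_iff.2 h) Δ.flipDiffeomorph_proj p
  rw [hmf u, hmf v, reducedForm, ← stdForm_flipMap]
  obtain ⟨h, hp⟩ := proj_localSection_chartAt Δ p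
  have ht := fun w => Δ.flipMap_mem_mirror_tangentU
    (Δ.fderiv_localSection_mem_tangentU (Δ.chartIndexAt p).2 h w)
  have hFp := Δ.flipDiffeomorph_proj ⟨_, Δ.localSection_mem (Δ.chartIndexAt p).2 h⟩
  rw [hp] at hFp
  have key := Δ.mirror.reducedForm_proj ⟨_, Δ.flipMap_mem_mirror_U_iff.2
    (Δ.localSection_mem (Δ.chartIndexAt p).2 h)⟩ (ht u) (ht v)
  rw [← hFp] at key
  exact key

theorem diagMomentMap_flipDiffeomorph (p : Δ.M) :
    Δ.mirror.diagMomentMap (Δ.flipDiffeomorph p) = Δ.diagMomentMap p := by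
  obtain ⟨x, rfl⟩ := Δ.proj_surjective p
  rw [flipDiffeomorph_proj]
  simp only [diagMomentMap, momentMap, lift_proj, norm_flipMap, Fin.rev_zero, Fin.rev_last]
  exact add_comm _ _

theorem flipDiffeomorph_antidiagAct (c : Circle) (p : Δ.M) :
    Δ.flipDiffeomorph (Δ.antidiagAct c p) = Δ.mirror.antidiagAct c (Δ.flipDiffeomorph p) := by
  obtain ⟨x, rfl⟩ := Δ.proj_surjective p
  rw [flipDiffeomorph_proj]
  simp only [antidiagAct, torusAct, lift_proj, flipDiffeomorph_proj]
  congr 1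
  refine Subtype.ext (funext fun l => ?_)
  have hl0 : Fin.last (m + 1) ≠ 0 := (Fin.last_pos (n := m)).ne'
  by_cases h0 : l = 0
  · subst h0
    simp [torusActU, flipMap_zero, hl0, ← Circle.coe_inv_eq_conj]
  by_cases h1 : l = Fin.last (m + 1)
  · subst h1
    simp [torusActU, flipMap_last, hl0, ← Circle.coe_inv_eq_conj]
  have h0' : l.rev ≠ 0 := fun h => h1 (by rw [← Fin.rev_rev l, h, Fin.rev_zero])
  have h1' : l.rev ≠ Fin.last (m + 1) := fun h => h0 (by rw [← Fin.rev_rev l, h, Fin.rev_last])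
  simp [torusActU, flipMap_of_ne_zero _ h0, h0, h1, h0', h1']

theorem flipDiffeomorph_mem_sphere_iff (p : Δ.M) (i : Fin (m + 2)) :
    Δ.flipDiffeomorph p ∈ Δ.mirror.sphere i ↔ p ∈ Δ.sphere i.rev := by
  obtain ⟨x, rfl⟩ := Δ.proj_surjective p
  rw [flipDiffeomorph_proj, mem_sphere, mem_sphere]
  exact flipMap_eq_zero_iff x.1 i

theorem image_sphere_flipDiffeomorph (i : Fin (m + 2)) :
    Δ.flipDiffeomorph '' Δ.sphere i = Δ.mirror.sphere i.rev := by
  ext q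
  obtain ⟨p, rfl⟩ := Δ.flipDiffeomorph.surjective q
  refine (Δ.flipDiffeomorph.injective.mem_set_image).trans ?_
  have h := Δ.flipDiffeomorph_mem_sphere_iff p i.rev
  rw [Fin.rev_rev] at h
  exact h.symm

theorem flipDiffeomorph_mem_chain_iff (p : Δ.M) :
    Δ.flipDiffeomorph p ∈ Δ.mirror.chain ↔ p ∈ Δ.chain := by
  simp only [chain, Set.mem_iUnion, exists_prop, flipDiffeomorph_mem_sphere_iff]
  constructor
  · rintro ⟨i, h0, h1, h⟩
    exact ⟨i.rev, fun e => h1 (by rw [← Fin.rev_rev i, e, Fin.rev_zero]),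
      fun e => h0 (by rw [← Fin.rev_rev i, e, Fin.rev_last]), h⟩
  · rintro ⟨i, h0, h1, h⟩
    exact ⟨i.rev, fun e => h1 (by rw [← Fin.rev_rev i, e, Fin.rev_zero]),
      fun e => h0 (by rw [← Fin.rev_rev i, e, Fin.rev_last]), by rwa [Fin.rev_rev]⟩

/-- The flip conjugates the monomials in the inner coordinates, and reverses their exponents. -/
theorem prod_flipMap_zpow (x : Fin (m + 2) → ℂ) (c : Fin (m + 2) → ℤ) :
    ∏ l ∈ {0, Fin.last (m + 1)}ᶜ, flipMap x l ^ c l.rev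
      = conj (∏ l ∈ {0, Fin.last (m + 1)}ᶜ, x l ^ c l) := by
  rw [map_prod]
  refine Finset.prod_nbij' Fin.rev Fin.rev ?_ ?_ (fun l _ => Fin.rev_rev l)
    (fun l _ => Fin.rev_rev l) fun l hl => ?_
  · intro l hl
    simpa [and_comm, Fin.rev_eq_iff] using hl
  · intro l hl
    simpa [and_comm, Fin.rev_eq_iff] using hl
  · have h0 : l ≠ 0 := by rintro rfl; simp at hl
    rw [flipMap_of_ne_zero _ h0, map_zpow₀]

theorem blowupMap_flipDiffeomorph (p : Δ.M) :
    Δ.mirror.blowupMap (Δ.flipDiffeomorph p)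
      = (-conj (Δ.blowupMap p).2, conj (Δ.blowupMap p).1) := by
  obtain ⟨x, rfl⟩ := Δ.proj_surjective p
  have h1 := prod_flipMap_zpow x.1 fun l => (Δ.normal l).1
  have h2 := prod_flipMap_zpow x.1 fun l => (Δ.normal l).2
  rw [flipDiffeomorph_proj, blowupMap_proj, blowupMap_proj]
  simp only [mirror, Prod.fst_swap, Prod.snd_swap, h1, h2, flipMap_zero, flipMap_last,
    RCLike.norm_conj, map_mul, map_div₀, Complex.conj_ofReal, neg_mul]

end CornerPolygon

theorem mainTheorem7 {m : ℕ} (Δ : CornerPolygon m) :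
    ∃ F : Diffeomorph 𝓘(ℝ, ℂ × ℂ) 𝓘(ℝ, ℂ × ℂ) Δ.M Δ.mirror.M ∞,
      -- `F` is induced by the map of `ℂⁿ`
      (∀ x : Δ.U, ∃ hx : flipMap x.1 ∈ Δ.mirror.U, F (Δ.proj x) = Δ.mirror.proj ⟨flipMap x.1, hx⟩) ∧
      -- `F` negates the symplectic form
      (∀ (p : Δ.M) (u v : TangentSpace 𝓘(ℝ, ℂ × ℂ) p),
        Δ.mirror.reducedForm (F p)
          (mfderiv 𝓘(ℝ, ℂ × ℂ) 𝓘(ℝ, ℂ × ℂ) F p u) (mfderiv 𝓘(ℝ, ℂ × ℂ) 𝓘(ℝ, ℂ × ℂ) F p v)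
          = -Δ.reducedForm p u v) ∧
      -- `F` intertwines the moment maps of the diagonal circle actions
      (∀ p : Δ.M, Δ.mirror.diagMomentMap (F p) = Δ.diagMomentMap p) ∧
      -- `F` is equivariant for the anti-diagonal circle actions
      (∀ (c : Circle) (p : Δ.M), F (Δ.antidiagAct c p) = Δ.mirror.antidiagAct c (F p)) ∧
      -- `F` maps `S_i` onto `S'_{n+1-i}`
      (∀ i : Fin (m + 2), F '' Δ.sphere i = Δ.mirror.sphere i.rev) ∧
      -- `F` in the coordinates given by the symplectic blowup maps
      (∀ z ∈ Δ.blowupMap '' Δ.chainᶜ, F (Δ.blowupMap.symm z) ∈ Δ.mirror.chainᶜ ∧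
        Δ.mirror.blowupMap (F (Δ.blowupMap.symm z)) = (-conj z.2, conj z.1)) := by
  refine ⟨Δ.flipDiffeomorph, fun x => ⟨_, Δ.flipDiffeomorph_proj x⟩,
    Δ.reducedForm_flipDiffeomorph, Δ.diagMomentMap_flipDiffeomorph, Δ.flipDiffeomorph_antidiagAct,
    Δ.image_sphere_flipDiffeomorph, ?_⟩
  rintro _ ⟨p, hp, rfl⟩
  rw [Δ.blowupMap.left_inv (by rwa [blowupMap_source])]
  exact ⟨fun h => hp ((Δ.flipDiffeomorph_mem_chain_iff p).1 h), Δ.blowupMap_flipDiffeomorph p⟩
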